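/- Let $n\ge 2$ and $d>2$ be integers, and let $f\in\mathbb{R}[x_1,\dots,x_n]$ denote a form (homogeneous polynomial) of degree $d$, with gradient $\nabla f$ and Hessian $\nabla^2 f$, whose eigenvalues at $x$, with multiplicity, are $\lambda_1(\nabla^2 f(x))\le\lambda_2(\nabla^2 f(x))\le\cdots$. Let $\mathbb{S}^{n-1}$ be the Euclidean unit sphere. A point $x^*\in\mathbb{S}^{n-1}$ with a multiplier $\lambda^*\in\mathbb{R}$ satisfies (FONC) if $\nabla f(x^*)+2\lambda^*x^*=0$; (SONC) if $u^T\nabla^2 f(x^*)u+2\lambda^*\ge 0$ for all $u\in\mathbb{S}^{n-1}$ with $u^Tx^*=0$; (SOSC) if $u^T\nabla^2 f(x^*)u+2\lambda^*> 0$ for all such $u$. Let $$\mathcal{D}(x)=\det\begin{pmatrix}\nabla^2 f(x)-d\,f(x)\,I & x\\ x^T & 0\end{pmatrix},$$ and consider the system of $n+1$ polynomial equations $$\frac{\partial f}{\partial x_i}(x)-d\,f(x)\,x_i=0\quad(i=1,\dots,n),\qquad \mathcal{D}(x)=0. \tag{$*$}$$ Let $q_1,\dots,q_n$ (of degree $d+1$)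 and $q_0$ (of degree $d(n-1)+2$) be the forms in $x_0,x_1,\dots,x_n$ obtained by homogenizing the left-hand sides, and let $Q(f)=\mathrm{Res}(q_0,q_1,\dots,q_n)$ be their multivariate resultant, a polynomial in the coefficients of $f$. Consider the following two properties of $f$. (A) Every point $x^*\in\mathbb{S}^{n-1}$ that satisfies (FONC) and (SONC), with the same multiplier, also satisfies (SOSC), with this multiplier, and is a local minimizer of $f$ on $\mathbb{S}^{n-1}$. (B) A point $x^*\in\mathbb{S}^{n-1}$ is a local minimizer of $f$ on $\mathbb{S}^{n-1}$ if and only if $\nabla f(x^*)=d\,f(x^*)\,x^*$ and $$\lambda_1(\nabla^2 f(x^*))\ge d\,f(x^*)\ \text{ if } f(x^*)\ge 0,\qquad \lambda_2(\nabla^2 f(x^*))\ge d\,f(x^*)\ \text{ if } f(x^*)<0.$$ Then: 1. If $Q(f)\ne 0$, then (A) and (B) hold. 2. More generally, if the system $(*)$ has no solution $x\in\mathbb{S}^{n-1}$, then (A) and (B) hold. 3. For a generic form $f$ of degree $d$ the system $(*)$ has no solution $x\in\mathbb{S}^{n-1}$, and (A) and (B) hold. Here "generic" means: there is a nonzero real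 polynomial $P$ in the coefficients of forms of degree $d$ in $n$ variables such that the assertion holds for every $f$ with $P(f)\neq 0$. -/

import Mathlib

open MvPolynomial

noncomputable section

/-! ## The multivariate resultant -/

/-- The exponents of the monomials of degree `k` in the variables `σ`. -/
abbrev Expo (σ : Type) [Fintype σ] [DecidableEq σ] (k : ℕ) : Type :=
  {m : σ →₀ ℕ // m ∈ (Finset.univ : Finset σ).finsuppAntidiag k}

namespace Resultant

variable {σ : Type} [Fintype σ] [DecidableEq σ]

/-- The coefficient variables of a system of forms `(F_j)`, one for each variable `j : σ`,
with `F_j` of degree `e j`. -/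
abbrev CoeffVar (e : σ → ℕ) : Type := Σ j : σ, Expo σ (e j)

/-- The generic form of degree `e j`: all its coefficients are independent variables. -/
def genericForm (e : σ → ℕ) (j : σ) : MvPolynomial σ (MvPolynomial (CoeffVar e) ℝ) :=
  ∑ m : Expo σ (e j), monomial m.1 (X ⟨j, m⟩)

/-- `r` is an inertia form (of degree zero) of the generic system: a polynomial in the
coefficients such that `r * x_i ^ N` lies in the ideal generated by the generic forms, for some
`N` and all variables `x_i`. These polynomials are the elimination ideal of the system. -/
def IsInertiaForm (e : σ → ℕ) (r : MvPolynomial (CoeffVar e) ℝ) : Prop :=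
  ∃ N : ℕ, ∀ i : σ, C r * X i ^ N ∈ Ideal.span (Set.range (genericForm e))

/-- The coefficients of the system `(x_j ^ e j)`. -/
def powerCoeffs (e : σ → ℕ) (c : CoeffVar e) : ℝ :=
  if c.2.1 = Finsupp.single c.1 (e c.1) then 1 else 0

/-- `R` is the resultant of forms of degrees `e`: it generates the elimination ideal of the generic
system, and it is normalized to be `1` at the system `(x_j ^ e j)`. -/
def IsResultant (e : σ → ℕ) (R : MvPolynomial (CoeffVar e) ℝ) : Prop :=
  (∀ r : MvPolynomial (CoeffVar e) ℝ, IsInertiaForm e r ↔ R ∣ r) ∧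
    eval (powerCoeffs e) R = 1

theorem IsResultant.unique {e : σ → ℕ} {R R' : MvPolynomial (CoeffVar e) ℝ}
    (h : IsResultant e R) (h' : IsResultant e R') : R = R' := by
  have h1 : R ∣ R' := (h.1 R').1 ((h'.1 R').2 dvd_rfl)
  have h2 : R' ∣ R := (h'.1 R).1 ((h.1 R).2 dvd_rfl)
  obtain ⟨u, hu⟩ := associated_of_dvd_dvd h1 h2
  obtain ⟨c, hc, hcu⟩ := (MvPolynomial.isUnit_iff_eq_C_of_isReduced).1 u.isUnit
  have h3 := h'.2
  rw [← hu, map_mul, h.2, hcu, eval_C, one_mul] at h3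
  rw [← hu, hcu, h3, C_1, mul_one]

open Classical in
/-- The multivariate resultant of `|σ|` forms of degrees `e` in the variables `σ`, a polynomial in
the coefficients of the forms. -/
def resultant (e : σ → ℕ) : MvPolynomial (CoeffVar e) ℝ :=
  if h : ∃ R, IsResultant e R then h.choose else 0

/-- `Res(F)`: the resultant, evaluated at the coefficients of the forms `F j` of degrees `e j`. -/
def Res (e : σ → ℕ) (F : σ → MvPolynomial σ ℝ) : ℝ :=
  eval (fun c : CoeffVar e => (F c.1).coeff c.2.1) (resultant e)

end Resultant

namespace SphereForm

variable {n : ℕ}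

/-! ## Gradient, Hessian, eigenvalues -/

/-- The gradient of `f` at `x`. -/
def grad (f : MvPolynomial (Fin n) ℝ) (x : EuclideanSpace ℝ (Fin n)) :
    EuclideanSpace ℝ (Fin n) :=
  WithLp.toLp 2 fun i => eval x.ofLp (pderiv i f)

/-- The Hessian matrix of `f`, with polynomial entries. -/
def hessPoly (f : MvPolynomial (Fin n) ℝ) : Matrix (Fin n) (Fin n) (MvPolynomial (Fin n) ℝ) :=
  Matrix.of fun i j => pderiv i (pderiv j f)

/-- The Hessian matrix of `f` at `x`. -/
def hess (f : MvPolynomial (Fin n) ℝ) (x : EuclideanSpace ℝ (Fin n)) :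
    Matrix (Fin n) (Fin n) ℝ :=
  Matrix.of fun i j => eval x.ofLp (pderiv i (pderiv j f))

theorem pderiv_comm' (i j : Fin n) (f : MvPolynomial (Fin n) ℝ) :
    pderiv i (pderiv j f) = pderiv j (pderiv i f) := by
  have h : ⁅(pderiv i : Derivation ℝ (MvPolynomial (Fin n) ℝ) (MvPolynomial (Fin n) ℝ)),
      (pderiv j : Derivation ℝ (MvPolynomial (Fin n) ℝ) (MvPolynomial (Fin n) ℝ))⁆ = 0 := by
    apply MvPolynomial.derivation_ext
    intro k
    rw [Derivation.commutator_apply, pderiv_X, pderiv_X]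
    simp only [Pi.single_apply]
    split_ifs <;> simp
  have h2 := congrArg (fun D => D f) h
  simpa [Derivation.commutator_apply, sub_eq_zero] using h2

theorem hess_isHermitian (f : MvPolynomial (Fin n) ℝ) (x : EuclideanSpace ℝ (Fin n)) :
    (hess f x).IsHermitian := by
  ext i j
  simp [hess, pderiv_comm' i j]

/-- `eig f x k` is `λ_{k+1}(∇²f(x))`: the eigenvalues of the Hessian with multiplicity, in
increasing order, numbered from `k = 0`. (Mathlib's `eigenvalues₀` is the decreasing list.) -/
def eig (f : MvPolynomial (Fin n) ℝ) (x : EuclideanSpace ℝ (Fin n)) (k : Fin n) : ℝ :=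
  (hess_isHermitian f x).eigenvalues₀ (Fin.cast (Fintype.card_fin n).symm k.rev)

/-! ## Optimality conditions on the unit sphere -/

/-- The unit sphere. -/
abbrev S (n : ℕ) : Set (EuclideanSpace ℝ (Fin n)) := Metric.sphere 0 1

/-- First-order necessary condition at `x`, with multiplier `lam`. -/
def FONC (f : MvPolynomial (Fin n) ℝ) (x : EuclideanSpace ℝ (Fin n)) (lam : ℝ) : Prop :=
  grad f x + (2 * lam) • x = 0

/-- Second-order necessary condition at `x`, with multiplier `lam`. -/
def SONC (f : MvPolynomial (Fin n) ℝ) (x : EuclideanSpace ℝ (Fin n)) (lam : ℝ) : Prop :=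
  ∀ u ∈ S n, inner ℝ u x = 0 → 0 ≤ u.ofLp ⬝ᵥ (Matrix.mulVec (hess f x) u.ofLp) + 2 * lam

/-- Second-order sufficient condition at `x`, with multiplier `lam`. -/
def SOSC (f : MvPolynomial (Fin n) ℝ) (x : EuclideanSpace ℝ (Fin n)) (lam : ℝ) : Prop :=
  ∀ u ∈ S n, inner ℝ u x = 0 → 0 < u.ofLp ⬝ᵥ (Matrix.mulVec (hess f x) u.ofLp) + 2 * lam

/-- `x` is a local minimizer of `f` on the unit sphere. -/
def IsSphereLocalMin (f : MvPolynomial (Fin n) ℝ) (x : EuclideanSpace ℝ (Fin n)) : Prop :=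
  x ∈ S n ∧ IsLocalMinOn (fun y : EuclideanSpace ℝ (Fin n) => eval y.ofLp f) (S n) x

/-- Every point of the sphere satisfying the first- and second-order necessary conditions also
satisfies the second-order sufficient condition and is a local minimizer. -/
def NecessaryImpliesSufficient (f : MvPolynomial (Fin n) ℝ) : Prop :=
  ∀ x ∈ S n, ∀ lam : ℝ, FONC f x lam → SONC f x lam → SOSC f x lam ∧ IsSphereLocalMin f x

/-- The local minimizers of `f` on the sphere are characterized by its gradient and the first two
eigenvalues of its Hessian. -/
def SpectralCharacterization (f : MvPolynomial (Fin n) ℝ) (d : ℕ) (hn : 2 ≤ n) : Prop :=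
  ∀ x ∈ S n, IsSphereLocalMin f x ↔
    grad f x = ((d : ℝ) * eval x.ofLp f) • x ∧
    (0 ≤ eval x.ofLp f → (d : ℝ) * eval x.ofLp f ≤ eig f x ⟨0, by omega⟩) ∧
    (eval x.ofLp f < 0 → (d : ℝ) * eval x.ofLp f ≤ eig f x ⟨1, by omega⟩)

/-! ## The polynomial system and its resultant -/

/-- The determinant `𝒟` of the bordered matrix `[[∇²f - d f I, x], [xᵀ, 0]]`, a polynomial
in `x`. -/
def borderedDet (f : MvPolynomial (Fin n) ℝ) (d : ℕ) : MvPolynomial (Fin n) ℝ :=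
  (Matrix.fromBlocks
    (hessPoly f - Matrix.scalar (Fin n) ((d : MvPolynomial (Fin n) ℝ) * f))
    (Matrix.replicateCol Unit (X : Fin n → MvPolynomial (Fin n) ℝ))
    (Matrix.replicateRow Unit (X : Fin n → MvPolynomial (Fin n) ℝ))
    0).det

/-- The polynomial `∂f/∂x_i - d f x_i`. -/
def critPoly (f : MvPolynomial (Fin n) ℝ) (d : ℕ) (i : Fin n) : MvPolynomial (Fin n) ℝ :=
  pderiv i f - (d : MvPolynomial (Fin n) ℝ) * f * X i

/-- Homogenization in degree `N`: `x_0 ^ N * p (x / x_0)`, for `p` of degree at most `N`. The new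
variable is number `0` and the old ones are shifted by one. -/
def homogenize (N : ℕ) (p : MvPolynomial (Fin n) ℝ) : MvPolynomial (Fin (n + 1)) ℝ :=
  ∑ m ∈ p.support, monomial (m.cons (N - m.degree)) (p.coeff m)

/-- The degrees of the homogenized system: `d (n - 1) + 2` for `𝒟` and `d + 1` for the others. -/
def sysDeg (n d : ℕ) : Fin (n + 1) → ℕ := Fin.cons (d * (n - 1) + 2) fun _ => d + 1

/-- The homogenized system `q_0, q_1, …, q_n`: `q_0` comes from `𝒟`, and `q_i` from
`∂f/∂x_i - d f x_i`. -/
def sys (f : MvPolynomial (Fin n) ℝ) (d : ℕ) : Fin (n + 1) → MvPolynomial (Fin (n + 1)) ℝ :=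
  Fin.cons (homogenize (d * (n - 1) + 2) (borderedDet f d)) fun i =>
    homogenize (d + 1) (critPoly f d i)

/-- `Q(f) = Res(q_0, q_1, …, q_n)`. -/
def Q (f : MvPolynomial (Fin n) ℝ) (d : ℕ) : ℝ := Resultant.Res (sysDeg n d) (sys f d)

/-- The system `∂f/∂x_i - d f x_i = 0` (`i = 1, …, n`), `𝒟 = 0` has no solution on the sphere. -/
def NoSphereSolution (f : MvPolynomial (Fin n) ℝ) (d : ℕ) : Prop :=
  ¬ ∃ x ∈ S n, (∀ i, eval x.ofLp (critPoly f d i) = 0) ∧ eval x.ofLp (borderedDet f d) = 0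

/-- A property `p` holds for generic forms of degree `d` in `n` variables: it holds for all forms
outside the zero set of some nonzero polynomial in the coefficients of the form. -/
def ForGenericForm (n d : ℕ) (p : MvPolynomial (Fin n) ℝ → Prop) : Prop :=
  ∃ P : MvPolynomial (Expo (Fin n) d) ℝ, P ≠ 0 ∧
    ∀ f : MvPolynomial (Fin n) ℝ, f.IsHomogeneous d →
      eval (fun m : Expo (Fin n) d => f.coeff m.1) P ≠ 0 → p f

end SphereForm

end

/-!
For a form, Euler's identities pin down the data at a critical point `x` on the sphere: the multiplier
is `-d f(x) / 2`, and `x` is an eigenvector of the Hessian with eigenvalue `d (d - 1) f(x)`.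

Suppose that the necessary conditions hold at `x`, so that the Hessian is at least `d f(x)` on the
tangent space. If equality is attained at some tangent `u ≠ 0`, then `u` minimizes a semidefinite
form, hence is an eigenvector for `d f(x)`, and `(u, 0)` is in the kernel of the bordered matrix. So
if the system has no solution on the sphere, then the sufficient condition holds
(`necessaryImpliesSufficient_of_noSphereSolution`), and a second-order Taylor expansion makes `x` a
local minimizer (`isSphereLocalMin_of_sosc`). As the necessary conditions hold at every local
minimizer, the local minimizers are the critical points where the Hessian is at least `d f(x)` on
the tangent space. If `f(x) ≥ 0`, the eigenvalue of `x` is at least `d f(x)` as well, and this is a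
condition on the smallest eigenvalue of the Hessian; if `f(x) < 0`, the eigenvalue of `x` is less than
`d f(x)`, and it is a condition on the second one (`sonc_iff_eig`).

A solution `x` of the system gives the common zero `(1, x)` of the homogenized forms. Some multiple
`R X_i ^ N` of the resultant `R` lies in the ideal of the generic forms, so `R` vanishes there
(`Resultant.Res_eq_zero_of_common_zero`).

Genericity is an algebraic version of Sard's theorem. Let `A` be the polynomial ring in the
coefficients of the generic form, and let `I` be the ideal of `A[x]` generated by the system and
`∑ x_i ^ 2 - 1`. Every element `P` of `I ∩ A` vanishes at the forms for which the system has a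
solution on the sphere. If `I ∩ A` were zero, then by the Nullstellensatz the generic form would
have a degenerate critical point `x` with coordinates in a finite extension of the fraction field of
`A`. The derivations `∂/∂c_m` of `A` extend to this field. Applied to the equations
`∂f/∂x_i = d f x_i` and contracted with a kernel vector `u` of the bordered matrix, they show that `u`
is orthogonal to the gradients at `x` of all monomials of degree `d`, so `u = 0`, a contradiction
(`not_degenerate_of_generic`).
-/

noncomputable section

namespace SphereForm

variable {n : ℕ}

/-! ### The system over an arbitrary ring -/

section Over

variable {R : Type*} [CommRing R]

/-- The polynomial `∂f/∂x_i - d f x_i` over an arbitrary coefficient ring; over `ℝ` this is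
`critPoly`. -/
def critPolyOver (f : MvPolynomial (Fin n) R) (d : ℕ) (i : Fin n) : MvPolynomial (Fin n) R :=
  pderiv i f - (d : MvPolynomial (Fin n) R) * f * X i

/-- The bordered determinant over an arbitrary coefficient ring; over `ℝ` this is
`borderedDet`. -/
def borderedDetOver (f : MvPolynomial (Fin n) R) (d : ℕ) : MvPolynomial (Fin n) R :=
  (Matrix.fromBlocks
    (Matrix.of (fun i j => pderiv i (pderiv j f)) -
      Matrix.scalar (Fin n) ((d : MvPolynomial (Fin n) R) * f))
    (Matrix.replicateCol Unit (X : Fin n → MvPolynomial (Fin n) R))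
    (Matrix.replicateRow Unit (X : Fin n → MvPolynomial (Fin n) R))
    0).det

theorem critPolyOver_real (f : MvPolynomial (Fin n) ℝ) (d : ℕ) (i : Fin n) :
    critPolyOver f d i = critPoly f d i := rfl

theorem borderedDetOver_real (f : MvPolynomial (Fin n) ℝ) (d : ℕ) :
    borderedDetOver f d = borderedDet f d := rfl

theorem map_critPolyOver {S : Type*} [CommRing S] (φ : R →+* S) (f : MvPolynomial (Fin n) R)
    (d : ℕ) (i : Fin n) : map φ (critPolyOver f d i) = critPolyOver (map φ f) d i := by
  simp [critPolyOver, pderiv_map]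

theorem map_borderedDetOver {S : Type*} [CommRing S] (φ : R →+* S) (f : MvPolynomial (Fin n) R)
    (d : ℕ) : map φ (borderedDetOver f d) = borderedDetOver (map φ f) d := by
  rw [borderedDetOver, borderedDetOver, RingHom.map_det]
  congr 1
  ext (i | i) (j | j) : 2 <;> simp [pderiv_map, Matrix.diagonal_apply, apply_ite (map φ)]

/-- The bordered determinant vanishes at `x` if and only if the bordered matrix has a nonzero
kernel vector `(u, t)`. -/
theorem eval_borderedDetOver_eq_zero_iff {K : Type*} [Field K] (f : MvPolynomial (Fin n) K)
    (d : ℕ) (x : Fin n → K) :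
    eval x (borderedDetOver f d) = 0 ↔ ∃ (u : Fin n → K) (t : K), (u ≠ 0 ∨ t ≠ 0) ∧
      (∀ i, ∑ j, eval x (pderiv i (pderiv j f)) * u j - d * eval x f * u i + x i * t = 0) ∧
      ∑ j, x j * u j = 0 := by
  rw [borderedDetOver, RingHom.map_det, ← Matrix.exists_mulVec_eq_zero_iff]
  have key : ∀ v : Fin n ⊕ Unit → K,
      Matrix.mulVec ((eval x).mapMatrix (Matrix.fromBlocks
        (Matrix.of (fun i j => pderiv i (pderiv j f)) -
          Matrix.scalar (Fin n) ((d : MvPolynomial (Fin n) K) * f))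
        (Matrix.replicateCol Unit (X : Fin n → MvPolynomial (Fin n) K))
        (Matrix.replicateRow Unit (X : Fin n → MvPolynomial (Fin n) K)) 0)) v = 0 ↔
      (∀ i, ∑ j, eval x (pderiv i (pderiv j f)) * v (Sum.inl j) - d * eval x f * v (Sum.inl i)
        + x i * v (Sum.inr ()) = 0) ∧ ∑ j, x j * v (Sum.inl j) = 0 := by
    intro v
    rw [funext_iff, Sum.forall]
    simp [Matrix.mulVec, dotProduct, Matrix.diagonal_apply, sub_mul, Finset.sum_sub_distrib,
      apply_ite (eval x)]
  constructor
  · rintro ⟨v, hv, h⟩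
    refine ⟨fun i => v (Sum.inl i), v (Sum.inr ()), ?_, (key v).1 h⟩
    by_contra! hc
    apply hv
    ext (i | i)
    · exact congrFun hc.1 i
    · exact hc.2
  · rintro ⟨u, t, h0, h⟩
    refine ⟨Sum.elim u fun _ => t, ?_, (key _).2 (by simpa using h)⟩
    intro hc
    rcases h0 with h0 | h0
    · exact h0 (funext fun i => congrFun hc (Sum.inl i))
    · exact h0 (congrFun hc (Sum.inr ()))

/-- The form of degree `d` with given coefficients; with the variables `X` as coefficients, it is
the generic form. -/
def formOfCoeffs {d : ℕ} (c : Expo (Fin n) d → R) : MvPolynomial (Fin n) R :=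
  ∑ m : Expo (Fin n) d, monomial m.1 (c m)

theorem map_formOfCoeffs {S : Type*} [CommRing S] (φ : R →+* S) {d : ℕ}
    (c : Expo (Fin n) d → R) : map φ (formOfCoeffs c) = formOfCoeffs (fun m => φ (c m)) := by
  simp [formOfCoeffs]

end Over

/-- A homogeneous polynomial is the sum of its monomials of the given degree. -/
theorem sum_monomial_coeff_of_isHomogeneous {R : Type*} [CommRing R] {σ : Type} [Fintype σ]
    [DecidableEq σ] {k : ℕ} {f : MvPolynomial σ R} (hf : f.IsHomogeneous k) :
    ∑ m : Expo σ k, monomial m.1 (f.coeff m.1) = f := by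
  ext m
  rw [coeff_sum]
  simp only [coeff_monomial]
  by_cases hm : m ∈ (Finset.univ : Finset σ).finsuppAntidiag k
  · rw [Finset.sum_eq_single ⟨m, hm⟩]
    · simp
    · intro b _ hb
      rw [if_neg]
      exact fun h => hb (Subtype.ext h)
    · simp
  · rw [Finset.sum_eq_zero]
    · symm
      by_contra h
      apply hm
      have := hf h
      simp only [Finset.mem_finsuppAntidiag, Finset.subset_univ, and_true]
      rw [← this, Finsupp.weight_apply, Finsupp.sum_fintype _ _ (by simp)]
      simp
    · intro b _
      rw [if_neg]
      rintro rfl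
      exact hm b.2

/-! ### Derivations on étale extensions of a polynomial ring -/

/-- The partial derivatives of a polynomial ring extend to every formally étale algebra over it:
the module of differentials of the algebra is the base change of that of the polynomial ring. -/
theorem exists_derivation_extending_pderiv {k σ L : Type*} [CommRing k] [CommRing L] [Algebra k L]
    [Algebra (MvPolynomial σ k) L] [IsScalarTower k (MvPolynomial σ k) L]
    [Algebra.FormallyEtale (MvPolynomial σ k) L] (i : σ) :
    ∃ D : Derivation k L L, ∀ p : MvPolynomial σ k,
      D (algebraMap _ L p) = algebraMap _ L (pderiv i p) := by
  let φ : Ω[MvPolynomial σ k⁄k] →ₗ[MvPolynomial σ k] L :=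
    (Algebra.linearMap (MvPolynomial σ k) L).comp
      ((Finsupp.lapply i).comp (KaehlerDifferential.mvPolynomialBasis k σ).repr.toLinearMap)
  let ψ := (φ.liftBaseChange L).comp
    (KaehlerDifferential.tensorKaehlerEquivOfFormallyEtale k (MvPolynomial σ k) L).symm.toLinearMap
  refine ⟨ψ.compDer (KaehlerDifferential.D k L), fun p => ?_⟩
  change (φ.liftBaseChange L)
    ((KaehlerDifferential.tensorKaehlerEquivOfFormallyEtale k (MvPolynomial σ k) L).symm
      (KaehlerDifferential.D k L (algebraMap _ L p))) = _
  rw [KaehlerDifferential.tensorKaehlerEquivOfFormallyEtale_symm_D_algebraMap]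
  simp [φ]

theorem derivation_aeval {k σ L : Type*} [Fintype σ] [CommRing k] [CommRing L] [Algebra k L]
    (D : Derivation k L L) (x : σ → L) (p : MvPolynomial σ k) :
    D (aeval x p) = ∑ j, aeval x (pderiv j p) * D (x j) := by
  classical
  induction p using MvPolynomial.induction_on with
  | C a => simp
  | add p q hp hq => simp [hp, hq, add_mul, Finset.sum_add_distrib]
  | mul_X p i hp =>
    simp only [map_mul, aeval_X, Derivation.leibniz, hp, smul_eq_mul, pderiv_X, map_add, add_mul,
      Finset.sum_add_distrib]
    congr 1
    · rw [Finset.sum_eq_single i] <;> simp +contextual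
    · rw [Finset.mul_sum]
      exact Finset.sum_congr rfl fun j _ => by ring

/-- The derivative of a linear combination of polynomials with coefficients `c l`, at a point whose
coordinates also vary: a Leibniz rule. -/
theorem derivation_sum_mul_aeval {ι k σ L : Type*} [Fintype ι] [DecidableEq ι] [Fintype σ]
    [CommRing k] [CommRing L] [Algebra k L] (D : Derivation k L L) (x : σ → L) (c : ι → L) (m : ι)
    (hc : ∀ l, D (c l) = if l = m then 1 else 0) (q : ι → MvPolynomial σ k) :
    D (∑ l, c l * aeval x (q l)) =
      aeval x (q m) + ∑ j, (∑ l, c l * aeval x (pderiv j (q l))) * D (x j) := by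
  simp only [map_sum, Derivation.leibniz, hc, smul_eq_mul, mul_ite, mul_one, mul_zero,
    Finset.sum_add_distrib, Finset.sum_ite_eq', Finset.mem_univ, if_true, derivation_aeval]
  rw [add_comm]
  congr 1
  simp only [Finset.mul_sum, Finset.sum_mul]
  rw [Finset.sum_comm]
  exact Finset.sum_congr rfl fun j _ => Finset.sum_congr rfl fun l _ => by ring

/-! ### Generic forms have no degenerate critical point on the sphere -/

/-- If `u` is orthogonal to the gradients at `x` of all monomials of degree `d`, and `x ≠ 0`, then
`u = 0`. -/
theorem eq_zero_of_orthogonal_grad_monomials {L : Type*} [Field L] [Algebra ℝ L] {d : ℕ}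
    (hd : 0 < d) {x u : Fin n → L} (hx : x ≠ 0)
    (h : ∀ m : Expo (Fin n) d, ∑ i, u i * aeval x (pderiv i (monomial m.1 (1 : ℝ))) = 0) :
    u = 0 := by
  classical
  obtain ⟨i, hi⟩ := Function.ne_iff.1 hx
  rw [Pi.zero_apply] at hi
  have hchar : CharZero L := charZero_of_injective_algebraMap (algebraMap ℝ L).injective
  obtain ⟨e, rfl⟩ : ∃ e, d = e + 1 := ⟨d - 1, by omega⟩
  -- The monomials `X_i ^ e * X_k` suffice.
  have key : ∀ k, ∑ l, u l * aeval x (pderiv l (X i ^ e * X k : MvPolynomial (Fin n) ℝ)) = 0 := by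
    intro k
    have hm : Finsupp.single i e + Finsupp.single k 1 ∈
        (Finset.univ : Finset (Fin n)).finsuppAntidiag (e + 1) := by
      simp [Finset.mem_finsuppAntidiag, Finset.sum_add_distrib, Finsupp.single_apply]
    have := h ⟨_, hm⟩
    rwa [show monomial (Finsupp.single i e + Finsupp.single k 1) (1 : ℝ) = X i ^ e * X k by
      rw [X_pow_eq_monomial, X, monomial_mul, one_mul]] at this
  have expand : ∀ k, u i * (e * x i ^ (e - 1) * x k) + u k * x i ^ e = 0 := by
    intro k
    rw [← key k]
    simp only [Derivation.leibniz, Derivation.leibniz_pow, pderiv_X, map_add, smul_eq_mul,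
      map_mul, map_pow, aeval_X, mul_add, Finset.sum_add_distrib]
    rw [add_comm]
    congr 1
    · rw [Finset.sum_eq_single k] <;> simp +contextual
    · rw [Finset.sum_eq_single i]
      · simp only [Pi.single_eq_same, mul_one, map_mul, nsmul_eq_mul, map_pow, map_natCast, aeval_X]
        ring
      · simp +contextual
      · simp
  have hui : u i = 0 := by
    have h1 := expand i
    have h2 : (e : L) * x i ^ (e - 1) * x i = e * x i ^ e := by
      rcases e with _ | e
      · simp
      · rw [Nat.add_sub_cancel, pow_succ, mul_assoc]
    rw [h2, show u i * (e * x i ^ e) + u i * x i ^ e = u i * ((e + 1 : ℕ) * x i ^ e) by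
      push_cast; ring] at h1
    exact (mul_eq_zero.1 h1).resolve_right
      (mul_ne_zero (Nat.cast_ne_zero.2 (by omega)) (pow_ne_zero _ hi))
  ext k
  have := expand k
  rw [hui, zero_mul, zero_add] at this
  exact (mul_eq_zero.1 this).resolve_right (pow_ne_zero _ hi)

/-- Over an étale extension of the ring of coefficients, the generic form has no degenerate critical
point on the sphere. This is Sard's theorem in algebraic form: the derivation extending `∂/∂c_m` is
applied to the critical point equations, and contracted with the kernel vector of the bordered
Hessian. -/
theorem not_degenerate_of_generic {d : ℕ} (hd : 0 < d) {L : Type*} [Field L] [Algebra ℝ L]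
    [Algebra (MvPolynomial (Expo (Fin n) d) ℝ) L]
    [IsScalarTower ℝ (MvPolynomial (Expo (Fin n) d) ℝ) L]
    [Algebra.FormallyEtale (MvPolynomial (Expo (Fin n) d) ℝ) L]
    (x : Fin n → L) (hx : ∑ i, x i * x i = 1)
    (hcrit : ∀ i, eval x (critPolyOver (formOfCoeffs fun m : Expo (Fin n) d =>
      algebraMap (MvPolynomial (Expo (Fin n) d) ℝ) L (X m)) d i) = 0) :
    eval x (borderedDetOver (formOfCoeffs fun m : Expo (Fin n) d =>
      algebraMap (MvPolynomial (Expo (Fin n) d) ℝ) L (X m)) d) ≠ 0 := by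
  intro hdet
  have hchar : CharZero L := charZero_of_injective_algebraMap (algebraMap ℝ L).injective
  obtain ⟨u, t, hut, hker, hxu⟩ := (eval_borderedDetOver_eq_zero_iff _ _ _).1 hdet
  set c : Expo (Fin n) d → L := fun m => algebraMap (MvPolynomial (Expo (Fin n) d) ℝ) L (X m)
  have hmono : ∀ m : Expo (Fin n) d,
      monomial m.1 (c m) = C (c m) * map (algebraMap ℝ L) (monomial m.1 1) := by
    intro m; simp [C_mul_monomial]
  have hF : eval x (formOfCoeffs c) = ∑ m, c m * aeval x (monomial m.1 (1 : ℝ)) := by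
    simp [formOfCoeffs, hmono, -map_monomial, aeval_def, eval_map]
  have hF1 : ∀ i, eval x (pderiv i (formOfCoeffs c)) =
      ∑ m, c m * aeval x (pderiv i (monomial m.1 (1 : ℝ))) := by
    intro i
    simp only [formOfCoeffs, hmono, map_sum, pderiv_C_mul, pderiv_map, map_mul,
      eval_C, eval_map, aeval_def]
  have hF2 : ∀ i j, eval x (pderiv i (pderiv j (formOfCoeffs c))) =
      ∑ m, c m * aeval x (pderiv i (pderiv j (monomial m.1 (1 : ℝ)))) := by
    intro i j
    simp only [formOfCoeffs, hmono, map_sum, pderiv_C_mul, pderiv_map, map_mul,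
      eval_C, eval_map, aeval_def]
  have hx0 : x ≠ 0 := by
    rintro rfl
    simp at hx
  have hu : u = 0 := by
    refine eq_zero_of_orthogonal_grad_monomials hd hx0 fun m => ?_
    obtain ⟨D, hD⟩ := exists_derivation_extending_pderiv (k := ℝ) (L := L) m
    have hDc : ∀ l, D (c l) = if l = m then 1 else 0 := by
      intro l
      rw [hD, pderiv_X, Pi.single_apply]
      split_ifs <;> simp
    have hxDx : ∑ i, x i * D (x i) = 0 := by
      have h := congrArg D hx
      simp only [map_sum, Derivation.leibniz, smul_eq_mul, Derivation.map_one_eq_zero,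
        ← two_mul, ← Finset.mul_sum] at h
      simpa using h
    have hD1 : ∀ i, D (eval x (pderiv i (formOfCoeffs c))) =
        aeval x (pderiv i (monomial m.1 (1 : ℝ))) +
          ∑ j, eval x (pderiv j (pderiv i (formOfCoeffs c))) * D (x j) := by
      intro i
      rw [hF1, derivation_sum_mul_aeval D x c m hDc]
      simp only [hF2]
    set F := eval x (formOfCoeffs c)
    have hcrit' : ∀ i, eval x (pderiv i (formOfCoeffs c)) = d * F * x i := by
      intro i
      have := hcrit i
      rw [critPolyOver] at this
      simpa [sub_eq_zero, F] using this
    have hDcrit : ∀ i, aeval x (pderiv i (monomial m.1 (1 : ℝ))) +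
        ∑ j, eval x (pderiv j (pderiv i (formOfCoeffs c))) * D (x j) =
          d * F * D (x i) + x i * D (d * F) := by
      intro i
      rw [← hD1, hcrit', Derivation.leibniz, smul_eq_mul, smul_eq_mul]
    have hsum : ∑ i, u i * (∑ j, eval x (pderiv j (pderiv i (formOfCoeffs c))) * D (x j)) =
        ∑ i, u i * (d * F * D (x i)) := by
      calc _ = ∑ j, (∑ i, eval x (pderiv j (pderiv i (formOfCoeffs c))) * u i) * D (x j) := by
            simp only [Finset.mul_sum, Finset.sum_mul]
            rw [Finset.sum_comm]
            exact Finset.sum_congr rfl fun j _ => Finset.sum_congr rfl fun i _ => by ring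
        _ = ∑ j, (u j * (d * F * D (x j)) - t * (x j * D (x j))) := by
            refine Finset.sum_congr rfl fun j _ => ?_
            linear_combination D (x j) * hker j
        _ = _ := by
            rw [Finset.sum_sub_distrib, ← Finset.mul_sum, hxDx, mul_zero, sub_zero]
    have htot : ∑ i, u i * (aeval x (pderiv i (monomial m.1 (1 : ℝ))) +
        ∑ j, eval x (pderiv j (pderiv i (formOfCoeffs c))) * D (x j)) =
          ∑ i, (u i * (d * F * D (x i)) + D (d * F) * (x i * u i)) :=
      Finset.sum_congr rfl fun i _ => by rw [hDcrit]; ring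
    simp only [mul_add, Finset.sum_add_distrib] at htot
    rw [hsum, ← Finset.mul_sum, hxu] at htot
    linear_combination htot
  obtain ⟨i, hi⟩ := Function.ne_iff.1 hx0
  have hk := hker i
  simp only [hu, Pi.zero_apply, mul_zero, Finset.sum_const_zero, sub_zero, zero_add] at hk
  rcases hut with h | h
  · exact h hu
  · exact (mul_ne_zero hi h) hk

/-- A Nullstellensatz with parameters: an ideal of `A[x]` that contains no nonzero element of the
domain `A` has a zero in a finite extension of the fraction field of `A`. -/
theorem exists_zero_in_finite_extension {A σ : Type} [CommRing A] [IsDomain A] [Finite σ]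
    (I : Ideal (MvPolynomial σ A)) (hI : ∀ P : A, C P ∈ I → P = 0) :
    ∃ (L : Type) (_ : Field L) (_ : Algebra (FractionRing A) L),
      Module.Finite (FractionRing A) L ∧ ∃ x : σ → L, ∀ p ∈ I,
        eval x (map ((algebraMap (FractionRing A) L).comp (algebraMap A (FractionRing A))) p)
          = 0 := by
  let _ : Algebra (MvPolynomial σ A) (MvPolynomial σ (FractionRing A)) :=
    MvPolynomial.algebraMvPolynomial
  have hne : I.map (algebraMap (MvPolynomial σ A) (MvPolynomial σ (FractionRing A))) ≠ ⊤ := by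
    rw [Ideal.ne_top_iff_one]
    intro h1
    obtain ⟨⟨a, s⟩, h⟩ := (IsLocalization.mem_map_algebraMap_iff
      ((nonZeroDivisors A).map (C (σ := σ))) (MvPolynomial σ (FractionRing A))).1 h1
    obtain ⟨P, hP, hPs⟩ := s.2
    have hinj : Function.Injective
        (algebraMap (MvPolynomial σ A) (MvPolynomial σ (FractionRing A))) := by
      rw [MvPolynomial.algebraMap_def]
      exact map_injective _ (IsFractionRing.injective A (FractionRing A))
    rw [one_mul] at h
    have := hinj h
    simp only at this
    have hs : C P ∈ I := by
      have hPs' : C P = (s : MvPolynomial σ A) := hPs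
      rw [hPs', this]
      exact a.2
    exact nonZeroDivisors.ne_zero hP (hI P hs)
  obtain ⟨M, hM, hIM⟩ := Ideal.exists_le_maximal _ hne
  let _ : Field (MvPolynomial σ (FractionRing A) ⧸ M) := Ideal.Quotient.field M
  refine ⟨MvPolynomial σ (FractionRing A) ⧸ M, inferInstance, inferInstance,
    finite_of_finite_type_of_isJacobsonRing _ _, fun i => Ideal.Quotient.mk M (X i), ?_⟩
  intro p hp
  have h1 : Ideal.Quotient.mk M (map (algebraMap A (FractionRing A)) p) = 0 :=
    Ideal.Quotient.eq_zero_iff_mem.2 (hIM (Ideal.mem_map_of_mem _ hp))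
  rw [← h1, ← map_map, eval_map]
  generalize map (algebraMap A (FractionRing A)) p = q
  induction q using MvPolynomial.induction_on with
  | C a => simp; rfl
  | add p q hp hq => simp [hp, hq]
  | mul_X p i hp => simp [hp]

/-- The ideal generated by the equations of the degenerate critical points on the sphere of the
generic form. -/
def degenerateIdeal (n d : ℕ) :
    Ideal (MvPolynomial (Fin n) (MvPolynomial (Expo (Fin n) d) ℝ)) :=
  Ideal.span (Set.range (critPolyOver (formOfCoeffs (d := d) X) d) ∪
    {borderedDetOver (formOfCoeffs (d := d) X) d, ∑ i, X i * X i - 1})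

theorem exists_ne_zero_mem_degenerateIdeal (n : ℕ) {d : ℕ} (hd : 0 < d) :
    ∃ P : MvPolynomial (Expo (Fin n) d) ℝ, P ≠ 0 ∧ C P ∈ degenerateIdeal n d := by
  by_contra! hcon
  obtain ⟨L, _, _, _, x, hx⟩ := exists_zero_in_finite_extension (degenerateIdeal n d)
    fun P hP => by_contra fun h => hcon P h hP
  let A := MvPolynomial (Expo (Fin n) d) ℝ
  let K := FractionRing A
  let _ : Algebra A L := ((algebraMap K L).comp (algebraMap A K)).toAlgebra
  have : IsScalarTower A K L := IsScalarTower.of_algebraMap_eq' rfl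
  let _ : Algebra ℝ L := ((algebraMap A L).comp (algebraMap ℝ A)).toAlgebra
  have : IsScalarTower ℝ A L := IsScalarTower.of_algebraMap_eq' rfl
  have : CharZero K := charZero_of_injective_algebraMap (algebraMap ℝ K).injective
  have : Algebra.FormallyEtale A K := Algebra.FormallyEtale.of_isLocalization (nonZeroDivisors A)
  have : Algebra.FormallyEtale K L := Algebra.FormallyEtale.of_isSeparable K L
  have : Algebra.FormallyEtale A L := Algebra.FormallyEtale.comp A K L
  change ∀ p ∈ _, eval x (map (algebraMap A L) p) = 0 at hx
  refine not_degenerate_of_generic hd x ?_ (fun i => ?_) ?_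
  · have := hx _ (Ideal.subset_span (Or.inr (Or.inr rfl)))
    simpa [sub_eq_zero] using this
  · have := hx _ (Ideal.subset_span (Or.inl ⟨i, rfl⟩))
    rwa [map_critPolyOver, map_formOfCoeffs] at this
  · have := hx _ (Ideal.subset_span (Or.inr (Or.inl rfl)))
    rwa [map_borderedDetOver, map_formOfCoeffs] at this

theorem sum_mul_self_of_mem_sphere {x : EuclideanSpace ℝ (Fin n)} (hx : x ∈ S n) :
    ∑ i, x i * x i = 1 := by
  have h : ‖x‖ = 1 := by simpa using hx
  have h2 := EuclideanSpace.real_norm_sq_eq x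
  rw [h] at h2
  simpa [sq] using h2.symm

theorem forGenericForm_noSphereSolution (n : ℕ) {d : ℕ} (hd : 0 < d) :
    ForGenericForm n d fun f => NoSphereSolution f d := by
  obtain ⟨P, hP, hmem⟩ := exists_ne_zero_mem_degenerateIdeal n hd
  refine ⟨P, hP, fun f hf hPf => ?_⟩
  rintro ⟨x, hx, hcrit, hdet⟩
  apply hPf
  let φ : MvPolynomial (Expo (Fin n) d) ℝ →+* ℝ := eval fun m : Expo (Fin n) d => f.coeff m.1
  have hφ : map φ (formOfCoeffs (d := d) X) = f := by
    rw [map_formOfCoeffs]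
    simpa [formOfCoeffs, φ] using sum_monomial_coeff_of_isHomogeneous hf
  have hle : degenerateIdeal n d ≤ RingHom.ker ((eval x.ofLp).comp (map φ)) := by
    rw [degenerateIdeal, Ideal.span_le]
    rintro p (⟨i, rfl⟩ | rfl | rfl)
    · simpa [RingHom.mem_ker, map_critPolyOver, hφ, critPolyOver_real] using hcrit i
    · simpa [RingHom.mem_ker, map_borderedDetOver, hφ, borderedDetOver_real] using hdet
    · simpa [RingHom.mem_ker, sub_eq_zero] using sum_mul_self_of_mem_sphere hx
  simpa [RingHom.mem_ker, φ] using hle hmem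

end SphereForm

namespace Resultant

variable {σ : Type} [Fintype σ] [DecidableEq σ]

/-! ### The resultant vanishes at systems with a common zero -/

theorem resultant_isInertiaForm (e : σ → ℕ) : IsInertiaForm e (resultant e) := by
  rw [resultant]
  split_ifs with h
  · exact (h.choose_spec.1 _).2 dvd_rfl
  -- The default value `0` is trivially an inertia form.
  · exact ⟨0, fun i => by simp⟩

/-- Specializing the relations `R * X_i ^ N ∈ (F_j)` at a common zero shows that the resultant
vanishes there. -/
theorem Res_eq_zero_of_common_zero {e : σ → ℕ} {F : σ → MvPolynomial σ ℝ}
    (hF : ∀ j, (F j).IsHomogeneous (e j)) {x : σ → ℝ} (hx : x ≠ 0)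
    (h : ∀ j, eval x (F j) = 0) : Res e F = 0 := by
  obtain ⟨N, hN⟩ := resultant_isInertiaForm e
  obtain ⟨i, hi⟩ := Function.ne_iff.1 hx
  let φ : MvPolynomial (CoeffVar e) ℝ →+* ℝ := eval fun c : CoeffVar e => (F c.1).coeff c.2.1
  have hle : Ideal.span (Set.range (genericForm e)) ≤ RingHom.ker ((eval x).comp (map φ)) := by
    rw [Ideal.span_le]
    rintro _ ⟨j, rfl⟩
    have : map φ (genericForm e j) = F j := by
      rw [genericForm, map_sum]
      simpa [φ] using SphereForm.sum_monomial_coeff_of_isHomogeneous (hF j)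
    simp [RingHom.mem_ker, this, h j]
  have := hle (hN i)
  simp only [RingHom.mem_ker, RingHom.comp_apply, map_mul, map_C, map_pow, map_X, eval_C,
    eval_X] at this
  exact (mul_eq_zero.1 this).resolve_right (pow_ne_zero _ hi)

end Resultant

namespace SphereForm

variable {n : ℕ}

/-! ### The homogenized system -/

theorem homogenize_isHomogeneous {N : ℕ} {p : MvPolynomial (Fin n) ℝ} (hp : p.totalDegree ≤ N) :
    (homogenize N p).IsHomogeneous N := by
  refine IsHomogeneous.sum _ _ _ fun m hm => isHomogeneous_monomial _ ?_
  have h1 : m.degree ≤ N := (le_totalDegree hm).trans hp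
  rw [Finsupp.degree_eq_sum, Fin.sum_univ_succ]
  simp only [Finsupp.cons_zero, Finsupp.cons_succ]
  rw [← Finsupp.degree_eq_sum]
  omega

theorem eval_homogenize (N : ℕ) (p : MvPolynomial (Fin n) ℝ) (x : Fin n → ℝ) :
    eval (Fin.cons 1 x : Fin (n + 1) → ℝ) (homogenize N p) = eval x p := by
  rw [homogenize, map_sum, eval_eq']
  refine Finset.sum_congr rfl fun m _ => ?_
  rw [eval_monomial, Finsupp.prod_fintype _ _ (by simp), Fin.prod_univ_succ]
  simp

/-- A bound for the degree of a determinant whose nonzero entries have degrees at most `a i + b j`.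
The weights are integers because a block of zeros may need a negative weight. -/
theorem totalDegree_det_le {R σ ι : Type*} [CommRing R] [Fintype ι] [DecidableEq ι]
    (M : Matrix ι ι (MvPolynomial σ R)) (a b : ι → ℤ)
    (h : ∀ i j, M i j ≠ 0 → ((M i j).totalDegree : ℤ) ≤ a i + b j) {N : ℕ}
    (hN : ∑ i, a i + ∑ j, b j ≤ N) : M.det.totalDegree ≤ N := by
  rw [Matrix.det_apply]
  refine totalDegree_finsetSum_le fun τ _ => ?_
  refine (totalDegree_smul_le _ _).trans ?_
  by_cases h0 : ∀ i, M (τ i) i ≠ 0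
  · refine (totalDegree_finsetProd _ _).trans ?_
    zify
    calc _ ≤ ∑ i, (a (τ i) + b i) := Finset.sum_le_sum fun i _ => h _ _ (h0 i)
      _ ≤ N := by rwa [Finset.sum_add_distrib, Equiv.sum_comp τ a]
  · push Not at h0
    obtain ⟨i, hi⟩ := h0
    rw [Finset.prod_eq_zero (f := fun i => M (τ i) i) (Finset.mem_univ i) hi]
    simp

theorem totalDegree_pderiv_le {R σ : Type*} [CommSemiring R] (i : σ) (p : MvPolynomial σ R) :
    (pderiv i p).totalDegree ≤ p.totalDegree := by
  classical
  conv_lhs => rw [p.as_sum, map_sum]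
  refine totalDegree_finsetSum_le fun m hm => ?_
  rw [pderiv_monomial]
  refine (totalDegree_monomial_le _ _).trans ((Finsupp.degree_mono tsub_le_self).trans ?_)
  exact le_totalDegree hm

theorem totalDegree_natCast_mul_le {R σ : Type*} [CommSemiring R] (k : ℕ) (p : MvPolynomial σ R) :
    ((k : MvPolynomial σ R) * p).totalDegree ≤ p.totalDegree := by
  refine (totalDegree_mul _ _).trans ?_
  rw [← map_natCast (C : R →+* MvPolynomial σ R), totalDegree_C, zero_add]

theorem totalDegree_critPoly_le {f : MvPolynomial (Fin n) ℝ} {d : ℕ} (hf : f.totalDegree ≤ d)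
    (i : Fin n) : (critPoly f d i).totalDegree ≤ d + 1 := by
  refine (totalDegree_sub _ _).trans (max_le ?_ ?_)
  · exact ((totalDegree_pderiv_le i f).trans hf).trans (Nat.le_succ d)
  · refine (totalDegree_mul _ _).trans (Nat.add_le_add ?_ (totalDegree_X i).le)
    exact (totalDegree_natCast_mul_le d f).trans hf

theorem totalDegree_borderedDet_le {f : MvPolynomial (Fin n) ℝ} {d : ℕ} (hf : f.totalDegree ≤ d)
    (hn : 1 ≤ n) : (borderedDet f d).totalDegree ≤ d * (n - 1) + 2 := by
  -- The weights `d, 1` of the rows and `0, 1 - d` of the columns are exact for three of the blocks.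
  -- The fourth block, of weight `2 - d`, is zero.
  refine totalDegree_det_le _ (Sum.elim (fun _ => (d : ℤ)) fun _ => 1)
    (Sum.elim (fun _ => 0) fun _ => 1 - d) ?_ ?_
  · have hdf : ((d : MvPolynomial (Fin n) ℝ) * f).totalDegree ≤ d :=
      (totalDegree_natCast_mul_le d f).trans hf
    rintro (i | i) (j | j) hij
    · simp only [Matrix.fromBlocks_apply₁₁, Sum.elim_inl, add_zero, Nat.cast_le, Matrix.sub_apply]
      refine (totalDegree_sub _ _).trans (max_le ?_ ?_)
      · exact ((totalDegree_pderiv_le _ _).trans (totalDegree_pderiv_le _ _)).trans hf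
      · rw [Matrix.scalar_apply, Matrix.diagonal_apply]
        split_ifs
        · exact hdf
        · simp
    · simp
    · simp
    · simp at hij
  · obtain ⟨k, rfl⟩ : ∃ k, n = k + 1 := ⟨n - 1, by omega⟩
    simp only [Fintype.sum_sum_type, Sum.elim_inl, Sum.elim_inr]
    simp
    nlinarith

theorem sys_isHomogeneous {f : MvPolynomial (Fin n) ℝ} {d : ℕ} (hf : f.IsHomogeneous d)
    (hn : 1 ≤ n) (j : Fin (n + 1)) : (sys f d j).IsHomogeneous (sysDeg n d j) := by
  refine Fin.cases ?_ (fun i => ?_) j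
  · exact homogenize_isHomogeneous (totalDegree_borderedDet_le hf.totalDegree_le hn)
  · exact homogenize_isHomogeneous (totalDegree_critPoly_le hf.totalDegree_le i)

/-- If the resultant of the homogenized system does not vanish, then the system has no solution; a
solution `x` gives the common zero `(1, x)`. -/
theorem noSphereSolution_of_Q_ne_zero {f : MvPolynomial (Fin n) ℝ} {d : ℕ}
    (hf : f.IsHomogeneous d) (hn : 1 ≤ n) (hQ : Q f d ≠ 0) :
    NoSphereSolution f d := by
  rintro ⟨x, -, hcrit, hdet⟩
  refine hQ (Resultant.Res_eq_zero_of_common_zero (sys_isHomogeneous hf hn)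
    (x := Fin.cons 1 x.ofLp) (fun h => ?_) fun j => ?_)
  · simpa using congrFun h 0
  · refine Fin.cases ?_ (fun i => ?_) j
    · exact (eval_homogenize _ _ _).trans hdet
    · exact (eval_homogenize _ _ _).trans (hcrit i)

end SphereForm

/-! ### Quadratic forms on a hyperplane and eigenvalues -/

section Quadratic

variable {E : Type*} [NormedAddCommGroup E] [InnerProductSpace ℝ E]

open scoped InnerProductSpace

theorem LinearMap.IsSymmetric.inner_add_self {T : E →ₗ[ℝ] E} (hT : T.IsSymmetric) (u w : E) :
    ⟪u + w, T (u + w)⟫_ℝ = ⟪u, T u⟫_ℝ + 2 * ⟪w, T u⟫_ℝ + ⟪w, T w⟫_ℝ := by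
  have h : ⟪u, T w⟫_ℝ = ⟪w, T u⟫_ℝ := by rw [← hT u w, real_inner_comm]
  rw [map_add, inner_add_left, inner_add_right, inner_add_right, h]
  ring

/-- Let the eigenvector `x` of the symmetric operator `T` be orthogonal to `u`. If `u` minimizes
`⟪w, T w⟫_ℝ - c ‖w‖ ^ 2` over `w ⟂ x`, with minimum `0`, then `u` is an eigenvector for `c`. -/
theorem LinearMap.IsSymmetric.apply_eq_smul_of_isotropic {T : E →ₗ[ℝ] E} (hT : T.IsSymmetric)
    {x u : E} {c μ : ℝ} (hTx : T x = μ • x)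
    (hpos : ∀ w : E, ⟪w, x⟫_ℝ = 0 → c * ‖w‖ ^ 2 ≤ ⟪w, T w⟫_ℝ)
    (hux : ⟪u, x⟫_ℝ = 0) (hu : ⟪u, T u⟫_ℝ = c * ‖u‖ ^ 2) : T u = c • u := by
  have hxT : ⟪x, T u⟫_ℝ = 0 := by
    rw [← hT x u, hTx, inner_smul_left, real_inner_comm, hux, mul_zero]
  set w := T u - c • u with hw
  have hwx : ⟪w, x⟫_ℝ = 0 := by
    rw [hw, inner_sub_left, inner_smul_left, hux, real_inner_comm, hxT]
    simp
  set a := ⟪w, T w⟫_ℝ - c * ‖w‖ ^ 2 with ha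
  have ha0 : 0 ≤ a := sub_nonneg.2 (hpos w hwx)
  have hb : ⟪w, T u⟫_ℝ - c * ⟪w, u⟫_ℝ = ‖w‖ ^ 2 := by
    rw [← real_inner_self_eq_norm_sq]
    nth_rw 4 [hw]
    rw [inner_sub_right, inner_smul_right]
  -- The form is nonnegative along the line `u + s w`, and its derivative at `u` is `2 ‖w‖ ^ 2`.
  have key : ∀ s : ℝ, 0 ≤ 2 * s * ‖w‖ ^ 2 + s ^ 2 * a := by
    intro s
    have h1 := hpos (u + s • w) (by rw [inner_add_left, inner_smul_left, hux, hwx]; simp)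
    rw [hT.inner_add_self, norm_add_sq_real, norm_smul, map_smul, inner_smul_left,
      inner_smul_left, inner_smul_right, inner_smul_right, hu, mul_pow, Real.norm_eq_abs,
      sq_abs, real_inner_comm] at h1
    simp only [conj_trivial] at h1
    rw [← hb, ha]
    linarith
  have h2 := key (-‖w‖ ^ 2 / (a + 1))
  have h3 : 2 * (-‖w‖ ^ 2 / (a + 1)) * ‖w‖ ^ 2 + (-‖w‖ ^ 2 / (a + 1)) ^ 2 * a =
      -(‖w‖ ^ 4 * (a + 2) / (a + 1) ^ 2) := by
    field_simp
    ring
  have h4 : ‖w‖ ^ 4 = 0 := by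
    by_contra h
    have : 0 < ‖w‖ ^ 4 * (a + 2) / (a + 1) ^ 2 := by positivity
    linarith
  have h5 : w = 0 := by simpa using h4
  exact sub_eq_zero.1 h5

variable {n : ℕ} {T : E →ₗ[ℝ] E} {v : OrthonormalBasis (Fin n) ℝ E} {ev : Fin n → ℝ}

theorem OrthonormalBasis.inner_apply_self_eq_sum (hv : ∀ k, T (v k) = ev k • v k) (u : E) :
    ⟪u, T u⟫_ℝ = ∑ k, ev k * ⟪v k, u⟫_ℝ ^ 2 := by
  have hTu : T u = ∑ k, ⟪v k, u⟫_ℝ • ev k • v k := by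
    conv_lhs => rw [← v.sum_repr' u, map_sum]
    simp [hv]
  rw [hTu, inner_sum]
  refine Finset.sum_congr rfl fun k _ => ?_
  rw [inner_smul_right, inner_smul_right, real_inner_comm]
  ring

theorem OrthonormalBasis.mul_norm_sq_le_inner_apply_self (hv : ∀ k, T (v k) = ev k • v k) {c : ℝ}
    {u : E} (h : ∀ k, ⟪v k, u⟫_ℝ = 0 ∨ c ≤ ev k) : c * ‖u‖ ^ 2 ≤ ⟪u, T u⟫_ℝ := by
  rw [v.inner_apply_self_eq_sum hv, ← v.sum_sq_inner_right, Finset.mul_sum]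
  refine Finset.sum_le_sum fun k _ => ?_
  rcases h k with h | h
  · simp [h]
  · exact mul_le_mul_of_nonneg_right h (sq_nonneg _)

/-- If the eigenvalue `μ` of the eigenvector `x` is at least `c`, then `T ≥ c` on the hyperplane
orthogonal to `x` if and only if the smallest eigenvalue is at least `c`. -/
theorem OrthonormalBasis.le_first_eigenvalue_iff (hv : ∀ k, T (v k) = ev k • v k)
    (hT : T.IsSymmetric) (hev : Monotone ev) (hn : 2 ≤ n) {x : E} {c μ : ℝ} (hx : ‖x‖ = 1)
    (hTx : T x = μ • x) (hc : c ≤ μ) :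
    c ≤ ev ⟨0, by omega⟩ ↔ ∀ u : E, ⟪u, x⟫_ℝ = 0 → c * ‖u‖ ^ 2 ≤ ⟪u, T u⟫_ℝ := by
  constructor
  · intro h u _
    exact v.mul_norm_sq_le_inner_apply_self hv fun k =>
      Or.inr (h.trans (hev (Fin.le_def.2 (Nat.zero_le _))))
  · intro h
    have h0 : ∀ w : E, c * ‖w‖ ^ 2 ≤ ⟪w, T w⟫_ℝ := by
      intro w
      set s := ⟪x, w⟫_ℝ
      have hu : ⟪w - s • x, x⟫_ℝ = 0 := by
        rw [inner_sub_left, inner_smul_left, real_inner_self_eq_norm_sq, hx, real_inner_comm]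
        simp [s]
      have h1 := h _ hu
      have h2 : w = (w - s • x) + s • x := by simp
      have h3 : ‖w‖ ^ 2 = ‖w - s • x‖ ^ 2 + s ^ 2 := by
        conv_lhs => rw [h2]
        rw [norm_add_sq_real, inner_smul_right, hu, norm_smul, hx]
        simp
      have h4 : ⟪w, T w⟫_ℝ = ⟪w - s • x, T (w - s • x)⟫_ℝ + s ^ 2 * μ := by
        conv_lhs => rw [h2, hT.inner_add_self]
        rw [inner_smul_left, ← hT x, map_smul, hTx, inner_smul_left, inner_smul_left,
          inner_smul_right, inner_smul_right, real_inner_self_eq_norm_sq, hx,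
          real_inner_comm (w - s • x) x, hu]
        simp
        ring
      rw [h3, h4]
      nlinarith [mul_le_mul_of_nonneg_left hc (sq_nonneg s)]
    have h5 := h0 (v ⟨0, by omega⟩)
    rw [hv, inner_smul_right, real_inner_self_eq_norm_sq, v.norm_eq_one] at h5
    simpa using h5

/-- If the eigenvalue `μ` of the eigenvector `x` is less than `c`, then `T ≥ c` on the hyperplane
orthogonal to `x` if and only if the second smallest eigenvalue is at least `c`. -/
theorem OrthonormalBasis.le_second_eigenvalue_iff (hv : ∀ k, T (v k) = ev k • v k)
    (hT : T.IsSymmetric) (hev : Monotone ev) (hn : 2 ≤ n) {x : E} {c μ : ℝ} (hx : x ≠ 0)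
    (hTx : T x = μ • x) (hc : μ < c) :
    c ≤ ev ⟨1, by omega⟩ ↔ ∀ u : E, ⟪u, x⟫_ℝ = 0 → c * ‖u‖ ^ 2 ≤ ⟪u, T u⟫_ℝ := by
  set i0 : Fin n := ⟨0, by omega⟩
  set i1 : Fin n := ⟨1, by omega⟩
  constructor
  · -- `x` spans the eigenspace of the first eigenvalue, so `u` has no component along `v i0`.
    intro h u hu
    have hk : ∀ k, k ≠ i0 → c ≤ ev k := fun k hk => h.trans (hev (by
      have : k.val ≠ 0 := fun h => hk (Fin.ext h)
      exact Fin.le_def.2 (Nat.one_le_iff_ne_zero.2 this)))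
    have hvx : ∀ k, k ≠ i0 → ⟪v k, x⟫_ℝ = 0 := by
      intro k hk0
      have h1 := hT (v k) x
      rw [hv, hTx, inner_smul_left, inner_smul_right] at h1
      have h2 : (ev k - μ) * ⟪v k, x⟫_ℝ = 0 := by
        rw [sub_mul, sub_eq_zero]; exact h1
      exact (mul_eq_zero.1 h2).resolve_left (by linarith [hk k hk0])
    have hx0 : x = ⟪v i0, x⟫_ℝ • v i0 := by
      conv_lhs => rw [← v.sum_repr' x]
      exact Finset.sum_eq_single i0 (fun k _ hk0 => by rw [hvx k hk0, zero_smul]) (by simp)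
    have hne : ⟪v i0, x⟫_ℝ ≠ 0 := by
      intro h0
      rw [h0, zero_smul] at hx0
      exact hx hx0
    have hu0 : ⟪v i0, u⟫_ℝ = 0 := by
      rw [hx0, inner_smul_right, real_inner_comm (v i0) u] at hu
      exact (mul_eq_zero.1 hu).resolve_left hne
    refine v.mul_norm_sq_le_inner_apply_self hv fun k => ?_
    by_cases hk0 : k = i0
    · exact Or.inl (hk0 ▸ hu0)
    · exact Or.inr (hk k hk0)
  · -- Otherwise the form is less than `c` on the plane of `v i0` and `v i1`, which meets the
    -- hyperplane.
    intro h
    by_contra! hlt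
    have hne : i0 ≠ i1 := fun h => by simp [i0, i1] at h
    have hle : ev i0 ≤ ev i1 := hev (Fin.le_def.2 (Nat.zero_le _))
    obtain ⟨a, b, hab, horth⟩ : ∃ a b : ℝ, 0 < a ^ 2 + b ^ 2 ∧
        a * ⟪v i0, x⟫_ℝ + b * ⟪v i1, x⟫_ℝ = 0 := by
      by_cases h0 : ⟪v i0, x⟫_ℝ = 0
      · exact ⟨1, 0, by norm_num, by simp [h0]⟩
      · exact ⟨⟪v i1, x⟫_ℝ, -⟪v i0, x⟫_ℝ, by rw [neg_sq]; positivity, by ring⟩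
    have h1 := h (a • v i0 + b • v i1) (by
      rwa [inner_add_left, inner_smul_left, inner_smul_left, conj_trivial, conj_trivial])
    have hn0 := v.norm_eq_one i0
    have hn1 := v.norm_eq_one i1
    have h01 : ⟪v i0, v i1⟫_ℝ = 0 := v.orthonormal.2 hne
    have h10 : ⟪v i1, v i0⟫_ℝ = 0 := v.orthonormal.2 hne.symm
    rw [norm_add_sq_real, hT.inner_add_self] at h1
    simp only [map_smul, hv, inner_smul_left, inner_smul_right, h01, h10, norm_smul, hn0, hn1,
      real_inner_self_eq_norm_sq, Real.norm_eq_abs, mul_pow, sq_abs, conj_trivial] at h1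
    have h2 : a ^ 2 * (c - ev i0) + b ^ 2 * (c - ev i1) ≤ 0 := by linarith
    have h3 : (a ^ 2 + b ^ 2) * (c - ev i1) ≤ 0 := by
      nlinarith [mul_le_mul_of_nonneg_left hle (sq_nonneg a)]
    exact absurd h3 (not_le.2 (mul_pos hab (sub_pos.2 hlt)))

end Quadratic

namespace SphereForm

variable {n : ℕ}

/-! ### The Hessian as a symmetric operator -/

/-- The Hessian of `f` at `x` as an operator of the Euclidean space. -/
def hessOp (f : MvPolynomial (Fin n) ℝ) (x : EuclideanSpace ℝ (Fin n)) :
    EuclideanSpace ℝ (Fin n) →ₗ[ℝ] EuclideanSpace ℝ (Fin n) :=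
  Matrix.toEuclideanLin (hess f x)

theorem hessOp_isSymmetric (f : MvPolynomial (Fin n) ℝ) (x : EuclideanSpace ℝ (Fin n)) :
    (hessOp f x).IsSymmetric :=
  Matrix.isSymmetric_toEuclideanLin_iff.2 (hess_isHermitian f x)

theorem hessOp_apply (f : MvPolynomial (Fin n) ℝ) (x u : EuclideanSpace ℝ (Fin n)) (i : Fin n) :
    hessOp f x u i = ∑ j, eval x.ofLp (pderiv i (pderiv j f)) * u j := by
  simp [hessOp, hess, Matrix.mulVec, dotProduct]

theorem dotProduct_hess_mulVec (f : MvPolynomial (Fin n) ℝ) (x u : EuclideanSpace ℝ (Fin n)) :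
    u.ofLp ⬝ᵥ (Matrix.mulVec (hess f x) u.ofLp) = inner ℝ u (hessOp f x u) := by
  rw [EuclideanSpace.inner_eq_star_dotProduct, dotProduct_comm]
  simp [hessOp]

theorem eig_monotone (f : MvPolynomial (Fin n) ℝ) (x : EuclideanSpace ℝ (Fin n)) :
    Monotone (eig f x) := by
  intro i j hij
  refine (hess_isHermitian f x).eigenvalues₀_antitone ?_
  simpa [Fin.le_def] using Fin.rev_le_rev.2 hij

theorem exists_eigenbasis (f : MvPolynomial (Fin n) ℝ) (x : EuclideanSpace ℝ (Fin n)) :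
    ∃ v : OrthonormalBasis (Fin n) ℝ (EuclideanSpace ℝ (Fin n)),
      ∀ k, hessOp f x (v k) = eig f x k • v k := by
  have hn : Fintype.card (Fin n) = n := Fintype.card_fin n
  let e : Fin (Fintype.card (Fin n)) ≃ Fin n := (finCongr hn).trans Fin.revPerm
  refine ⟨((Matrix.isSymmetric_toEuclideanLin_iff.mpr (hess_isHermitian f x)).eigenvectorBasis
    finrank_euclideanSpace).reindex e, fun k => ?_⟩
  rw [OrthonormalBasis.reindex_apply]
  exact LinearMap.IsSymmetric.apply_eigenvectorBasis _ _ _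

open Filter Topology Asymptotics

/-! ### Second-order expansion of a polynomial -/

/-- Taylor's formula of order two for polynomials. -/
theorem taylor_isBigO (f : MvPolynomial (Fin n) ℝ) (x : EuclideanSpace ℝ (Fin n)) :
    (fun h : EuclideanSpace ℝ (Fin n) => eval (x + h).ofLp f - eval x.ofLp f -
      ∑ i, eval x.ofLp (pderiv i f) * h i -
      (1 / 2) * ∑ i, ∑ j, eval x.ofLp (pderiv i (pderiv j f)) * h i * h j)
        =O[𝓝 0] fun h => ‖h‖ ^ 3 := by
  have hcoord : ∀ i : Fin n,
      (fun h : EuclideanSpace ℝ (Fin n) => h i) =O[𝓝 0] fun h => ‖h‖ := fun i =>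
    IsBigO.of_norm_le fun h => PiLp.norm_apply_le h i
  induction f using MvPolynomial.induction_on with
  | C a => simpa using isBigO_zero _ _
  | add p q hp hq =>
    refine (hp.add hq).congr_left fun h => ?_
    simp only [map_add, add_mul, Finset.sum_add_distrib]
    ring
  | mul_X p k hp =>
    -- With `R_p` the remainder and `Q_p` the quadratic term of `p`, the remainder of `p * X_k` is
    -- `R_p(h) (x_k + h_k) + Q_p(h) h_k / 2`.
    have hbdd : (fun h : EuclideanSpace ℝ (Fin n) => x k + h k) =O[𝓝 0] fun _ => (1 : ℝ) :=
      (Continuous.tendsto (by fun_prop) 0).isBigO_one ℝ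
    have hquad : (fun h : EuclideanSpace ℝ (Fin n) => ((1 / 2 : ℝ) * ∑ i, ∑ j,
        eval x.ofLp (pderiv i (pderiv j p)) * h i * h j) * h k) =O[𝓝 0] fun h => ‖h‖ ^ 3 := by
      have h2 : (fun h : EuclideanSpace ℝ (Fin n) => (1 / 2 : ℝ) * ∑ i, ∑ j,
          eval x.ofLp (pderiv i (pderiv j p)) * h i * h j) =O[𝓝 0] fun h => ‖h‖ * ‖h‖ :=
        (IsBigO.fun_sum fun i _ => IsBigO.fun_sum fun j _ =>
          ((hcoord i).const_mul_left _).mul (hcoord j)).const_mul_left _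
      exact (h2.mul (hcoord k)).congr_right fun h => by ring
    refine (((hp.mul hbdd).congr_right fun h => mul_one _).add hquad).congr_left fun h => ?_
    have hX : ∀ i, eval x.ofLp (pderiv i (X k : MvPolynomial (Fin n) ℝ)) =
        if i = k then 1 else 0 := by
      intro i
      by_cases h : i = k
      · simp [h]
      · rw [if_neg h, pderiv_X_of_ne (Ne.symm h), map_zero]
    have hXX : ∀ i j, pderiv i (pderiv j (X k : MvPolynomial (Fin n) ℝ)) = 0 := by
      intro i j
      rw [pderiv_X, Pi.single_apply]
      split_ifs <;> simp
    have h1 : ∑ i, eval x.ofLp (pderiv i (p * X k)) * h i =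
        (∑ i, eval x.ofLp (pderiv i p) * h i) * x k + eval x.ofLp p * h k := by
      simp only [Derivation.leibniz, smul_eq_mul, map_add, map_mul, hX, eval_X, add_mul,
        Finset.sum_add_distrib, mul_ite, ite_mul, mul_one, mul_zero, zero_mul,
        Finset.sum_ite_eq', Finset.mem_univ, if_true, Finset.sum_mul]
      rw [add_comm]
      congr 1
      exact Finset.sum_congr rfl fun i _ => by ring
    have h2 : ∑ i, ∑ j, eval x.ofLp (pderiv i (pderiv j (p * X k))) * h i * h j =
        (∑ i, ∑ j, eval x.ofLp (pderiv i (pderiv j p)) * h i * h j) * x k +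
          2 * (∑ i, eval x.ofLp (pderiv i p) * h i) * h k := by
      have hterm : ∀ i j, eval x.ofLp (pderiv i (pderiv j (p * X k))) * h i * h j =
          eval x.ofLp (pderiv i (pderiv j p)) * h i * h j * x k +
          (if j = k then eval x.ofLp (pderiv i p) * h i * h j else 0) +
          (if i = k then eval x.ofLp (pderiv j p) * h i * h j else 0) := by
        intro i j
        simp only [Derivation.leibniz, smul_eq_mul, map_add, map_mul, hX, hXX, eval_X, map_zero]
        split_ifs <;> ring
      simp only [hterm, Finset.sum_add_distrib, Finset.sum_ite_eq', Finset.mem_univ, if_true,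
        Finset.sum_mul]
      rw [Finset.sum_comm (f := fun i j => if i = k then _ else _)]
      simp only [Finset.sum_ite_eq', Finset.mem_univ, if_true, Finset.mul_sum, Finset.sum_mul]
      rw [add_assoc, ← Finset.sum_add_distrib]
      congr 1
      exact Finset.sum_congr rfl fun i _ => by ring
    rw [h1, h2]
    simp only [map_mul, eval_X, PiLp.add_apply]
    ring

theorem inner_grad_eq_sum (f : MvPolynomial (Fin n) ℝ) (x h : EuclideanSpace ℝ (Fin n)) :
    inner ℝ (grad f x) h = ∑ i, eval x.ofLp (pderiv i f) * h i := by
  simp [PiLp.inner_apply, grad, mul_comm]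

theorem inner_hessOp_eq_sum (f : MvPolynomial (Fin n) ℝ) (x h : EuclideanSpace ℝ (Fin n)) :
    inner ℝ h (hessOp f x h) =
      ∑ i, ∑ j, eval x.ofLp (pderiv i (pderiv j f)) * h i * h j := by
  rw [PiLp.inner_apply]
  refine Finset.sum_congr rfl fun i _ => ?_
  rw [hessOp_apply]
  simp only [RCLike.inner_apply, conj_trivial, Finset.sum_mul]
  exact Finset.sum_congr rfl fun j _ => by ring

theorem taylor_inner_isBigO (f : MvPolynomial (Fin n) ℝ) (x : EuclideanSpace ℝ (Fin n)) :
    (fun h : EuclideanSpace ℝ (Fin n) => eval (x + h).ofLp f - eval x.ofLp f -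
      inner ℝ (grad f x) h - (1 / 2) * inner ℝ h (hessOp f x h)) =O[𝓝 0] fun h => ‖h‖ ^ 3 := by
  simpa only [inner_grad_eq_sum, inner_hessOp_eq_sum] using taylor_isBigO f x

/-! ### Euler's identities -/

variable {f : MvPolynomial (Fin n) ℝ} {d : ℕ}

theorem inner_grad_self (hf : f.IsHomogeneous d) (x : EuclideanSpace ℝ (Fin n)) :
    inner ℝ (grad f x) x = d * eval x.ofLp f := by
  have h := congrArg (eval x.ofLp) hf.sum_X_mul_pderiv
  rw [inner_grad_eq_sum]
  simpa [mul_comm] using h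

theorem hessOp_self (hf : f.IsHomogeneous d) (hd : 1 ≤ d) (x : EuclideanSpace ℝ (Fin n)) :
    hessOp f x x = ((d : ℝ) - 1) • grad f x := by
  ext i
  have h := congrArg (eval x.ofLp) (hf.pderiv (i := i)).sum_X_mul_pderiv
  rw [hessOp_apply]
  simp only [pderiv_comm' i]
  simpa [mul_comm, grad, Nat.cast_sub hd] using h

theorem eval_smul_of_isHomogeneous (hf : f.IsHomogeneous d) (c : ℝ)
    (v : EuclideanSpace ℝ (Fin n)) : eval (c • v).ofLp f = c ^ d * eval v.ofLp f := by
  rw [eval_eq', eval_eq', Finset.mul_sum]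
  refine Finset.sum_congr rfl fun m hm => ?_
  have hdeg : ∑ i, m i = d := by
    rw [← hf (mem_support_iff.1 hm), Finsupp.weight_apply, Finsupp.sum_fintype _ _ (by simp)]
    simp
  simp only [PiLp.smul_apply, smul_eq_mul, mul_pow, Finset.prod_mul_distrib,
    Finset.prod_pow_eq_pow_sum, hdeg]
  ring

theorem fonc_iff (hf : f.IsHomogeneous d) {x : EuclideanSpace ℝ (Fin n)} (hx : x ∈ S n)
    {lam : ℝ} : FONC f x lam ↔
      grad f x = ((d : ℝ) * eval x.ofLp f) • x ∧ 2 * lam = -((d : ℝ) * eval x.ofLp f) := by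
  have hx1 : inner ℝ x x = 1 := by
    have : ‖x‖ = 1 := by simpa using hx
    rw [real_inner_self_eq_norm_sq, this, one_pow]
  constructor
  · intro h
    have hg : grad f x = (-(2 * lam)) • x := by
      rw [neg_smul]; exact eq_neg_of_add_eq_zero_left h
    have h2 := inner_grad_self hf x
    rw [hg, inner_smul_left, hx1] at h2
    simp only [conj_trivial, mul_one] at h2
    exact ⟨by rw [hg, h2], by linarith⟩
  · rintro ⟨h1, h2⟩
    rw [FONC, h1, h2, neg_smul, add_neg_cancel]

theorem sonc_iff {x : EuclideanSpace ℝ (Fin n)} {lam : ℝ} :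
    SONC f x lam ↔ ∀ u : EuclideanSpace ℝ (Fin n), inner ℝ u x = 0 →
      -(2 * lam) * ‖u‖ ^ 2 ≤ inner ℝ u (hessOp f x u) := by
  constructor
  · intro h u hu
    by_cases hu0 : u = 0
    · simp [hu0]
    have hpos : 0 < ‖u‖ := norm_pos_iff.2 hu0
    have h1 := h (‖u‖⁻¹ • u) (by simp [norm_smul, hpos.ne'])
      (by rw [inner_smul_left, hu, mul_zero])
    rw [dotProduct_hess_mulVec, map_smul, inner_smul_left, inner_smul_right, conj_trivial] at h1
    have h2 := mul_nonneg h1 (sq_nonneg ‖u‖)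
    have h3 : (‖u‖⁻¹ * (‖u‖⁻¹ * inner ℝ u (hessOp f x u)) + 2 * lam) * ‖u‖ ^ 2 =
        inner ℝ u (hessOp f x u) + 2 * lam * ‖u‖ ^ 2 := by
      field_simp
    linarith
  · intro h u hu hux
    have hu1 : ‖u‖ = 1 := by simpa using hu
    have h1 := h u hux
    rw [hu1] at h1
    rw [dotProduct_hess_mulVec]
    linarith

/-! ### Optimality conditions -/

/-- The second-order sufficient condition: the expansion of `f` at `x` has the leading term
`⟪h, (∇²f + 2 lam) h⟫ / 2`, which is at least a multiple of `‖h‖ ^ 2` for `h` almost tangent. -/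
theorem isSphereLocalMin_of_sosc (hf : f.IsHomogeneous d) (hd : 1 ≤ d)
    {x : EuclideanSpace ℝ (Fin n)} (hx : x ∈ S n) {lam : ℝ} (h1 : FONC f x lam)
    (h2 : SOSC f x lam) : IsSphereLocalMin f x := by
  refine ⟨hx, ?_⟩
  have hx1 : ‖x‖ = 1 := by simpa using hx
  have hTcont : Continuous (hessOp f x) := LinearMap.continuous_of_finiteDimensional _
  -- By compactness the strict inequality is uniform: the weak one holds for a smaller multiplier.
  obtain ⟨c, hc, hcS⟩ : ∃ c > 0, SONC f x (lam - c / 2) := by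
    have hK : IsCompact (S n ∩ {u | inner ℝ u x = 0}) :=
      (isCompact_sphere 0 1).inter_right (isClosed_eq (by fun_prop) continuous_const)
    obtain ⟨c, hc, hle⟩ := hK.exists_forall_le'
      (f := fun u => inner ℝ u (hessOp f x u) + 2 * lam) (by fun_prop) (a := 0) (fun u hu => by
        have := h2 u hu.1 hu.2
        rwa [dotProduct_hess_mulVec] at this)
    refine ⟨c, hc, fun u hu hux => ?_⟩
    have := hle u ⟨hu, hux⟩
    rw [dotProduct_hess_mulVec]
    linarith
  rw [sonc_iff] at hcS
  obtain ⟨hg, -⟩ := (fonc_iff hf hx).1 h1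
  have hg' : grad f x = (-(2 * lam)) • x := by
    rw [neg_smul]; exact eq_neg_of_add_eq_zero_left h1
  set μ := ((d : ℝ) - 1) * -(2 * lam) with hμ
  have hTx : hessOp f x x = μ • x := by rw [hessOp_self hf hd, hg', smul_smul]
  set K := |μ - c + 2 * lam| with hK
  have hquad : ∀ h : EuclideanSpace ℝ (Fin n),
      c * ‖h‖ ^ 2 - K * (inner ℝ x h) ^ 2 ≤ inner ℝ h (hessOp f x h) + 2 * lam * ‖h‖ ^ 2 := by
    intro h
    set s : ℝ := inner ℝ x h
    have hw : inner ℝ (h - s • x) x = 0 := by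
      rw [inner_sub_left, inner_smul_left, real_inner_self_eq_norm_sq, hx1, real_inner_comm]
      simp [s]
    have e0 : h = (h - s • x) + s • x := by simp
    have e1 : ‖h‖ ^ 2 = ‖h - s • x‖ ^ 2 + s ^ 2 := by
      conv_lhs => rw [e0]
      rw [norm_add_sq_real, inner_smul_right, hw, norm_smul, hx1]
      simp
    have e2 : inner ℝ h (hessOp f x h) =
        inner ℝ (h - s • x) (hessOp f x (h - s • x)) + s ^ 2 * μ := by
      conv_lhs => rw [e0, (hessOp_isSymmetric f x).inner_add_self]
      rw [inner_smul_left, ← hessOp_isSymmetric f x x, map_smul, hTx, inner_smul_left,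
        inner_smul_left, inner_smul_right, inner_smul_right, real_inner_self_eq_norm_sq, hx1,
        real_inner_comm (h - s • x) x, hw]
      simp
      ring
    have e3 := hcS _ hw
    have e4 : -K ≤ μ - c + 2 * lam := neg_abs_le _
    rw [e2, e1]
    nlinarith [mul_le_mul_of_nonneg_right e4 (sq_nonneg s)]
  obtain ⟨C, hC⟩ := (taylor_inner_isBigO f x).bound
  have hsmall : ∀ᶠ h : EuclideanSpace ℝ (Fin n) in 𝓝 0, C * ‖h‖ + K / 8 * ‖h‖ ^ 2 < c / 2 := by
    refine Tendsto.eventually_lt_const (half_pos hc) ?_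
    have : Continuous fun h : EuclideanSpace ℝ (Fin n) => C * ‖h‖ + K / 8 * ‖h‖ ^ 2 := by fun_prop
    simpa using this.tendsto 0
  have htend : Tendsto (fun y : EuclideanSpace ℝ (Fin n) => y - x) (𝓝[S n] x) (𝓝 0) := by
    have : Continuous fun y : EuclideanSpace ℝ (Fin n) => y - x := by fun_prop
    simpa using (this.tendsto x).mono_left nhdsWithin_le_nhds
  filter_upwards [htend.eventually hC, htend.eventually hsmall, self_mem_nhdsWithin]
    with y hy1 hy2 hyS
  have hyn : ‖y‖ = 1 := by simpa using hyS
  set h := y - x with hh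
  have hyx : x + h = y := by simp [hh]
  have hs : inner ℝ x h = -(‖h‖ ^ 2) / 2 := by
    have := norm_add_sq_real x h
    rw [hyx, hyn, hx1] at this
    linarith
  have hq := hquad h
  rw [hyx, hg', inner_smul_left, hs, norm_pow, norm_norm, Real.norm_eq_abs, conj_trivial] at hy1
  rw [hs] at hq
  have hr := (abs_le.1 hy1).1
  have hfin := mul_le_mul_of_nonneg_right hy2.le (sq_nonneg ‖h‖)
  nlinarith

/-- A function that is nonnegative near `0` and equal to `a t + b t ^ 2` up to a cubic error has
`a = 0` and `b ≥ 0`. -/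
theorem eq_zero_and_nonneg_of_isBigO {ψ : ℝ → ℝ} {a b : ℝ}
    (h : (fun t => ψ t - (a * t + b * t ^ 2)) =O[𝓝 0] fun t => t ^ 3)
    (hψ : ∀ᶠ t in 𝓝 0, 0 ≤ ψ t) : a = 0 ∧ 0 ≤ b := by
  obtain ⟨C, hC⟩ := h.bound
  have hev : ∀ᶠ t in 𝓝 (0 : ℝ), 0 ≤ a * t + b * t ^ 2 + C * |t| ^ 3 := by
    filter_upwards [hC, hψ] with t h1 h2
    rw [norm_pow, Real.norm_eq_abs, Real.norm_eq_abs] at h1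
    linarith [(abs_le.1 h1).2]
  have hlim : ∀ p q : ℝ, Tendsto (fun t : ℝ => p + q * t + C * t ^ 2) (𝓝[>] 0) (𝓝 p) := by
    intro p q
    have : Continuous fun t : ℝ => p + q * t + C * t ^ 2 := by fun_prop
    simpa using (this.tendsto 0).mono_left nhdsWithin_le_nhds
  have hright : 0 ≤ a := by
    refine ge_of_tendsto (hlim a b) ?_
    filter_upwards [nhdsWithin_le_nhds hev, self_mem_nhdsWithin] with t h1 (ht : 0 < t)
    rw [abs_of_pos ht] at h1
    refine nonneg_of_mul_nonneg_left (b := t) ?_ ht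
    linarith
  have hleft : 0 ≤ -a := by
    have hneg : Tendsto (fun t : ℝ => -t) (𝓝[>] 0) (𝓝 0) := by
      simpa using (continuous_neg.tendsto (0 : ℝ)).mono_left nhdsWithin_le_nhds
    refine ge_of_tendsto (hlim (-a) b) ?_
    filter_upwards [hneg.eventually hev, self_mem_nhdsWithin] with t h1 (ht : 0 < t)
    rw [abs_neg, abs_of_pos ht] at h1
    refine nonneg_of_mul_nonneg_left (b := t) ?_ ht
    linarith
  have ha : a = 0 := by linarith
  refine ⟨ha, ?_⟩
  have hlim' : Tendsto (fun t : ℝ => b + C * t) (𝓝[>] 0) (𝓝 b) := by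
    have : Continuous fun t : ℝ => b + C * t := by fun_prop
    simpa using (this.tendsto 0).mono_left nhdsWithin_le_nhds
  refine ge_of_tendsto hlim' ?_
  filter_upwards [nhdsWithin_le_nhds hev, self_mem_nhdsWithin] with t h1 (ht : 0 < t)
  rw [abs_of_pos ht, ha] at h1
  refine nonneg_of_mul_nonneg_left (b := t ^ 2) ?_ (by positivity)
  linarith

theorem one_add_sq_pow_isBigO (d : ℕ) :
    (fun t : ℝ => (1 + t ^ 2) ^ d - 1 - d * t ^ 2) =O[𝓝 0] fun t => t ^ 3 := by
  have hbdd : ∀ g : ℝ → ℝ, Continuous g → (fun t : ℝ => t ^ 3 * g t) =O[𝓝 0] fun t => t ^ 3 := by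
    intro g hg
    exact ((isBigO_refl _ _).mul ((hg.tendsto 0).isBigO_one ℝ)).congr_right fun t => mul_one _
  induction d with
  | zero => simpa using isBigO_zero _ _
  | succ d ih =>
    have h1 : (fun t : ℝ => ((1 + t ^ 2) ^ d - 1 - d * t ^ 2) * (1 + t ^ 2)) =O[𝓝 0]
        fun t => t ^ 3 := by
      have : Continuous fun t : ℝ => 1 + t ^ 2 := by fun_prop
      exact (ih.mul ((this.tendsto 0).isBigO_one ℝ)).congr_right fun t => mul_one _
    refine (h1.add (hbdd (fun t => d * t) (by fun_prop))).congr_left fun t => ?_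
    push_cast
    ring

/-- The first- and second-order conditions in a tangent direction `u` at a local minimizer `x`, from
the expansion of `f` along the circle `((1 - t ^ 2) x + 2 t u) / (1 + t ^ 2)`. By homogeneity the
denominator only contributes the factor `(1 + t ^ 2) ^ d`. -/
theorem IsSphereLocalMin.tangent_conditions (hf : f.IsHomogeneous d)
    {x : EuclideanSpace ℝ (Fin n)} (hmin : IsSphereLocalMin f x) {u : EuclideanSpace ℝ (Fin n)}
    (hu : u ∈ S n) (hux : inner ℝ u x = 0) :
    inner ℝ (grad f x) u = 0 ∧ d * eval x.ofLp f ≤ inner ℝ u (hessOp f x u) := by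
  have hx1 : ‖x‖ = 1 := by simpa using hmin.1
  have hu1 : ‖u‖ = 1 := by simpa using hu
  let η : ℝ → EuclideanSpace ℝ (Fin n) := fun t => t • ((2 : ℝ) • u - t • x)
  have hη : Continuous η := by fun_prop
  have hη0 : Tendsto η (𝓝 0) (𝓝 0) := by simpa [η] using hη.tendsto 0
  have hηO : η =O[𝓝 0] fun t => t := by
    have : Continuous fun t : ℝ => (2 : ℝ) • u - t • x := by fun_prop
    exact ((isBigO_refl (fun t : ℝ => t) _).smul ((this.tendsto 0).isBigO_one ℝ)).congr_right
      fun t => by simp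
  have hnorm : ∀ t, ‖x + η t‖ = 1 + t ^ 2 := by
    intro t
    have h1 : ‖x + η t‖ ^ 2 = (1 + t ^ 2) ^ 2 := by
      have : x + η t = (1 - t ^ 2) • x + (2 * t) • u := by
        simp only [η]
        module
      rw [this, norm_add_sq_real, inner_smul_left, inner_smul_right, real_inner_comm, hux,
        norm_smul, norm_smul, hx1, hu1, mul_one, mul_one, Real.norm_eq_abs, Real.norm_eq_abs,
        sq_abs, sq_abs]
      simp
      ring
    exact (pow_left_inj₀ (norm_nonneg _) (by positivity) two_ne_zero).1 h1
  have hrem : (fun t => eval (x + η t).ofLp f - eval x.ofLp f - inner ℝ (grad f x) (η t) -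
      (1 / 2) * inner ℝ (η t) (hessOp f x (η t))) =O[𝓝 0] fun t : ℝ => t ^ 3 :=
    ((taylor_inner_isBigO f x).comp_tendsto hη0).trans (hηO.norm_left.pow 3)
  have hquad : (fun t : ℝ => t ^ 3 * (-2 * inner ℝ x (hessOp f x u) +
      t * (inner ℝ x (hessOp f x x) / 2))) =O[𝓝 0] fun t => t ^ 3 := by
    have : Continuous fun t : ℝ => -2 * inner ℝ x (hessOp f x u) +
      t * (inner ℝ x (hessOp f x x) / 2) := by fun_prop
    exact ((isBigO_refl _ _).mul ((this.tendsto 0).isBigO_one ℝ)).congr_right fun t => mul_one _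
  have hexp : (fun t => (eval (x + η t).ofLp f - (1 + t ^ 2) ^ d * eval x.ofLp f) -
      (2 * inner ℝ (grad f x) u * t + (2 * inner ℝ u (hessOp f x u) - 2 * (d * eval x.ofLp f)) *
        t ^ 2)) =O[𝓝 0] fun t : ℝ => t ^ 3 := by
    refine ((hrem.add hquad).sub ((one_add_sq_pow_isBigO d).const_mul_left
      (eval x.ofLp f))).congr_left fun t => ?_
    have e1 : inner ℝ (grad f x) (η t) =
        2 * t * inner ℝ (grad f x) u - t ^ 2 * (d * eval x.ofLp f) := by
      simp only [η, inner_smul_right, inner_sub_right, inner_grad_self hf]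
      ring
    have e2 : inner ℝ (η t) (hessOp f x (η t)) = t ^ 2 * (4 * inner ℝ u (hessOp f x u) -
        4 * t * inner ℝ x (hessOp f x u) + t ^ 2 * inner ℝ x (hessOp f x x)) := by
      have hsymm : inner ℝ u (hessOp f x x) = inner ℝ x (hessOp f x u) := by
        rw [← hessOp_isSymmetric f x u x, real_inner_comm]
      simp only [η, map_smul, map_sub, inner_smul_left, inner_smul_right, inner_sub_left,
        inner_sub_right, conj_trivial, hsymm]
      ring
    rw [e1, e2]
    ring
  have hnonneg : ∀ᶠ t : ℝ in 𝓝 0,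
      0 ≤ eval (x + η t).ofLp f - (1 + t ^ 2) ^ d * eval x.ofLp f := by
    let y : ℝ → EuclideanSpace ℝ (Fin n) := fun t => (1 + t ^ 2)⁻¹ • (x + η t)
    have hpos : ∀ t : ℝ, 0 < 1 + t ^ 2 := fun t => by positivity
    have hyS : ∀ t, y t ∈ S n := by
      intro t
      change (1 + t ^ 2)⁻¹ • (x + η t) ∈ S n
      rw [mem_sphere_zero_iff_norm, norm_smul, hnorm, norm_inv, Real.norm_of_nonneg (hpos t).le,
        inv_mul_cancel₀ (hpos t).ne']
    have hy : Tendsto y (𝓝 0) (𝓝[S n] x) := by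
      refine tendsto_nhdsWithin_iff.2 ⟨?_, Eventually.of_forall hyS⟩
      have : Continuous y :=
        (Continuous.inv₀ (by fun_prop) fun t => (hpos t).ne').smul (continuous_const.add hη)
      simpa [y, η] using this.tendsto 0
    filter_upwards [hy.eventually hmin.2] with t ht
    have e : x + η t = (1 + t ^ 2) • y t := by
      simp only [y]
      rw [smul_inv_smul₀ (hpos t).ne']
    rw [e, eval_smul_of_isHomogeneous hf, ← mul_sub]
    exact mul_nonneg (pow_nonneg (hpos t).le _) (sub_nonneg.2 ht)
  obtain ⟨ha, hb⟩ := eq_zero_and_nonneg_of_isBigO hexp hnonneg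
  constructor <;> linarith

/-- The necessary conditions at a local minimizer; the multiplier is given by Euler's identity. -/
theorem IsSphereLocalMin.fonc_and_sonc (hf : f.IsHomogeneous d) {x : EuclideanSpace ℝ (Fin n)}
    (hmin : IsSphereLocalMin f x) :
    FONC f x (-(d * eval x.ofLp f) / 2) ∧ SONC f x (-(d * eval x.ofLp f) / 2) := by
  have hx1 : ‖x‖ = 1 := by simpa using hmin.1
  constructor
  · rw [fonc_iff hf hmin.1]
    refine ⟨?_, by ring⟩
    set w := grad f x - ((d : ℝ) * eval x.ofLp f) • x with hw
    have hwx : inner ℝ w x = 0 := by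
      rw [hw, inner_sub_left, inner_grad_self hf, inner_smul_left, real_inner_self_eq_norm_sq, hx1]
      simp
    by_cases hw0 : w = 0
    · exact sub_eq_zero.1 hw0
    have hpos : 0 < ‖w‖ := norm_pos_iff.2 hw0
    have h1 := (hmin.tangent_conditions hf (u := ‖w‖⁻¹ • w) (by simp [norm_smul, hpos.ne'])
      (by rw [inner_smul_left, hwx, mul_zero])).1
    have hgw : inner ℝ (grad f x) w = 0 := by
      rw [inner_smul_right] at h1
      exact (mul_eq_zero.1 h1).resolve_left (inv_ne_zero hpos.ne')
    have hww : inner ℝ w w = 0 := by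
      nth_rw 1 [hw]
      rw [inner_sub_left, inner_smul_left, hgw, real_inner_comm, hwx]
      simp
    exact absurd (inner_self_eq_zero.1 hww) hw0
  · intro u hu hux
    rw [dotProduct_hess_mulVec]
    linarith [(hmin.tangent_conditions hf hu hux).2]

/-! ### Nondegeneracy -/

/-- A tangent direction in which the second-order sufficient condition fails is an eigenvector of
the Hessian for `d f(x)`, hence in the kernel of the bordered matrix. -/
theorem necessaryImpliesSufficient_of_noSphereSolution (hf : f.IsHomogeneous d) (hd : 1 ≤ d)
    (hno : NoSphereSolution f d) : NecessaryImpliesSufficient f := by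
  intro x hx lam h1 h2
  have hsosc : SOSC f x lam := by
    intro u hu hux
    by_contra! hle
    have hu1 : ‖u‖ = 1 := by simpa using hu
    obtain ⟨hg, hlam⟩ := (fonc_iff hf hx).1 h1
    have hzero := le_antisymm hle (h2 u hu hux)
    rw [dotProduct_hess_mulVec] at hzero
    have hTu : hessOp f x u = ((d : ℝ) * eval x.ofLp f) • u := by
      refine (hessOp_isSymmetric f x).apply_eq_smul_of_isotropic (x := x)
        (μ := ((d : ℝ) - 1) * (d * eval x.ofLp f)) ?_ ?_ hux ?_
      · rw [hessOp_self hf hd, hg, smul_smul]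
      · intro w hw
        have := sonc_iff.1 h2 w hw
        rwa [hlam, neg_neg] at this
      · rw [hu1]
        linarith
    refine hno ⟨x, hx, fun i => ?_, ?_⟩
    · have := congrArg (fun v : EuclideanSpace ℝ (Fin n) => v i) hg
      simp only [grad, PiLp.smul_apply, smul_eq_mul] at this
      simp [critPoly, this]
    · rw [← borderedDetOver_real, eval_borderedDetOver_eq_zero_iff]
      refine ⟨u.ofLp, 0, Or.inl fun h => ?_, fun i => ?_, ?_⟩
      · have : u = 0 := by
          ext i
          exact congrFun h i
        simp [this] at hu1
      · have := congrArg (fun v : EuclideanSpace ℝ (Fin n) => v i) hTu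
        simp only [hessOp_apply, PiLp.smul_apply, smul_eq_mul] at this
        simp [this]
      · simpa [PiLp.inner_apply] using hux
  exact ⟨hsosc, isSphereLocalMin_of_sosc hf hd hx h1 hsosc⟩

/-- The eigenvalue of `x` is `d (d - 1) f(x)`. It is at least `d f(x)` if `f(x) ≥ 0`, and it is the
smallest eigenvalue otherwise. -/
theorem sonc_iff_eig (hf : f.IsHomogeneous d) (hn : 2 ≤ n) (hd : 2 < d)
    {x : EuclideanSpace ℝ (Fin n)} (hx : x ∈ S n)
    (hg : grad f x = ((d : ℝ) * eval x.ofLp f) • x) :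
    SONC f x (-(d * eval x.ofLp f) / 2) ↔
      (0 ≤ eval x.ofLp f → (d : ℝ) * eval x.ofLp f ≤ eig f x ⟨0, by omega⟩) ∧
      (eval x.ofLp f < 0 → (d : ℝ) * eval x.ofLp f ≤ eig f x ⟨1, by omega⟩) := by
  have hx1 : ‖x‖ = 1 := by simpa using hx
  have hx0 : x ≠ 0 := norm_ne_zero_iff.1 (by rw [hx1]; exact one_ne_zero)
  have hd' : (2 : ℝ) < d := by exact_mod_cast hd
  have hTx : hessOp f x x = (((d : ℝ) - 1) * (d * eval x.ofLp f)) • x := by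
    rw [hessOp_self hf (by omega), hg, smul_smul]
  obtain ⟨v, hv⟩ := exists_eigenbasis f x
  rw [sonc_iff, show -(2 * (-(d * eval x.ofLp f) / 2)) = d * eval x.ofLp f by ring]
  rcases le_or_gt 0 (eval x.ofLp f) with h | h
  · have hc : d * eval x.ofLp f ≤ ((d : ℝ) - 1) * (d * eval x.ofLp f) := by
      have : 0 ≤ d * eval x.ofLp f := by positivity
      nlinarith
    rw [← v.le_first_eigenvalue_iff hv (hessOp_isSymmetric f x) (eig_monotone f x) hn hx1 hTx hc]
    simp [h, h.not_gt]
  · have hc : ((d : ℝ) - 1) * (d * eval x.ofLp f) < d * eval x.ofLp f := by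
      have : d * eval x.ofLp f < 0 := mul_neg_of_pos_of_neg (by linarith) h
      nlinarith
    rw [← v.le_second_eigenvalue_iff hv (hessOp_isSymmetric f x) (eig_monotone f x) hn hx0 hTx hc]
    simp [h, h.not_ge]

theorem NecessaryImpliesSufficient.spectralCharacterization (h : NecessaryImpliesSufficient f)
    (hf : f.IsHomogeneous d) (hn : 2 ≤ n) (hd : 2 < d) : SpectralCharacterization f d hn := by
  intro x hx
  constructor
  · intro hmin
    obtain ⟨h1, h2⟩ := hmin.fonc_and_sonc hf
    have hg := ((fonc_iff hf hx).1 h1).1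
    exact ⟨hg, (sonc_iff_eig hf hn hd hx hg).1 h2⟩
  · rintro ⟨hg, heig⟩
    exact (h x hx _ ((fonc_iff hf hx).2 ⟨hg, by ring⟩) ((sonc_iff_eig hf hn hd hx hg).2 heig)).2

end SphereForm

theorem theorem3p4 (n d : ℕ) (hn : 2 ≤ n) (hd : 2 < d) :
    (∀ f : MvPolynomial (Fin n) ℝ, f.IsHomogeneous d → SphereForm.Q f d ≠ 0 →
      SphereForm.NecessaryImpliesSufficient f ∧
      SphereForm.SpectralCharacterization f d hn) ∧
    (∀ f : MvPolynomial (Fin n) ℝ, f.IsHomogeneous d → SphereForm.NoSphereSolution f d →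
      SphereForm.NecessaryImpliesSufficient f ∧
      SphereForm.SpectralCharacterization f d hn) ∧
    SphereForm.ForGenericForm n d (fun f =>
      SphereForm.NoSphereSolution f d ∧
      SphereForm.NecessaryImpliesSufficient f ∧
      SphereForm.SpectralCharacterization f d hn) := by
  have main : ∀ f : MvPolynomial (Fin n) ℝ, f.IsHomogeneous d → SphereForm.NoSphereSolution f d →
      SphereForm.NecessaryImpliesSufficient f ∧ SphereForm.SpectralCharacterization f d hn :=
    fun f hf hno =>
    have h := SphereForm.necessaryImpliesSufficient_of_noSphereSolution hf (by omega) hno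
    ⟨h, h.spectralCharacterization hf hn hd⟩
  refine ⟨fun f hf hQ =>
    main f hf (SphereForm.noSphereSolution_of_Q_ne_zero hf (by omega) hQ), main, ?_⟩
  obtain ⟨P, hP, hgen⟩ := SphereForm.forGenericForm_noSphereSolution n (d := d) (by omega)
  exact ⟨P, hP, fun f hf hPf => ⟨hgen f hf hPf, main f hf (hgen f hf hPf)⟩⟩

end
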